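/- Let $n\ge 1$. A Jacobi matrix is a real symmetric tridiagonal $n\times n$ matrix whose off-diagonal entries in positions $(j,j+1)$ and $(j+1,j)$, $1\le j\le n-1$, are strictly positive. For a Jacobi matrix $J$ and $k>0$ put $J_{k,\times}=J(I+ik\,e_1e_1^*)$, where $e_1$ is the first standard basis vector. For $z\in\mathbb C$ let $\operatorname{Arg}_{[0,\pi)}z$ be $\operatorname{Arg} z\in(0,\pi)$ if $\operatorname{Im}z>0$, $0$ if $z\in\mathbb R$, and $\pi+\operatorname{Arg} z\in(0,\pi)$ if $\operatorname{Im}z<0$, where $\operatorname{Arg}$ is the principal argument. Let $$\mathcal Z_n=\Big\{\{z_j\}_{j=1}^n\in(\mathbb C\setminus\mathbb R)^n:\ \sum_{j=1}^n\operatorname{Arg}_{[0,\pi)}z_j<\tfrac{\pi}{2}\Big\},$$ where configurations are unordered and points may be repeated. Eigenvalues are counted with algebraic multiplicity. (i) If $J$ is an $n\times n$ Jacobi matrix with $\det J\neq0$ and $k>0$, then the spectrum of $J_{k,\times}$ belongs to $\mathcal Z_n$. Moreover, the number of eigenvalues of $J_{k,\times}$ in the open upper (respectively, lower) half-plane equals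 the number of positive (respectively, negative) eigenvalues of $J$. (ii) Conversely, for every configuration in $\mathcal Z_n$ there is a unique pair $(J,k)$, where $J$ is an $n\times n$ Jacobi matrix and $k>0$, such that the configuration is the spectrum of $J_{k,\times}$; moreover, $\det J\neq0$ for this pair. -/

import Mathlib

noncomputable section

/-- A finite Jacobi matrix: a real symmetric tridiagonal matrix whose entries next to the main
diagonal are strictly positive (the diagonal entries are arbitrary real numbers). -/
structure IsJacobi {n : ℕ} (J : Matrix (Fin n) (Fin n) ℝ) : Prop where
  symm : ∀ i j, J i j = J j i
  offDiag_pos : ∀ i j : Fin n, (i : ℕ) + 1 = (j : ℕ) → 0 < J i j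
  tridiag : ∀ i j : Fin n, (i : ℕ) + 1 < (j : ℕ) → J i j = 0

/-- The rank-one multiplicative perturbation `J (I + i k e₁ e₁*)` of a real matrix `J`.
The matrix unit `Matrix.single 0 0 1` is `e₁ e₁*`. -/
def multPerturb {n : ℕ} [NeZero n] (J : Matrix (Fin n) (Fin n) ℝ) (k : ℝ) :
    Matrix (Fin n) (Fin n) ℂ :=
  J.map Complex.ofReal * (1 + (Complex.I * (k : ℂ)) • Matrix.single (0 : Fin n) (0 : Fin n) (1 : ℂ))

/-- The eigenvalues of a square matrix in the field `K`, each repeated according to its algebraic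
multiplicity. -/
def eigenvalueMultiset {K : Type*} [Field K] {n : ℕ} (A : Matrix (Fin n) (Fin n) K) : Multiset K :=
  A.charpoly.roots

/-- The argument modulo `π`: it is `Arg z` in the open upper half-plane, `0` on the real line, and
`π + Arg z` in the open lower half-plane. -/
def argModPi (z : ℂ) : ℝ :=
  if 0 < z.im then Complex.arg z else if z.im < 0 then Real.pi + Complex.arg z else 0

/-- Unordered configurations (with repetitions allowed) of `n` non-real points, the sum of whose
arguments modulo `π` is less than `π / 2`. -/
def multConfigurations (n : ℕ) : Set (Multiset ℂ) :=
  {Z | Z.card = n ∧ (∀ z ∈ Z, z.im ≠ 0) ∧ (Z.map argModPi).sum < Real.pi / 2}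

end

open Matrix Polynomial
open scoped Topology

/-! ### Triangular factorizations -/

/-! Diagonalise `J = U diag(λ) Uᵀ` and put `r_j = k U_{0j}²`. The characteristic polynomial `F` of
`J_{k,×}` satisfies `F/A = 1 - i ∑ λ_j r_j/(x - λ_j)` with `A = ∏ (x - λ_j)`
(`charpoly_multPerturb`). On the real line `F = ρ e^{iφ}` with `ρ` real of constant sign, and `φ`
(`phase`) is the sum of the arguments modulo `π` of `z - x` over the zeros `z`. So `φ(0)` is the sum
in the definition of the configurations, while `φ` tends to `πp` at `+∞` and `πq` at `-∞`, where `p`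
and `q` count the zeros in the upper and lower half-planes.

Since `Re F = A`, the levels `π/2 + πℤ` are met exactly at the `λ_j`. The sign of `λ_j r_j` makes
`φ` cross them upward when moving away from `0` on either side. Also `tan φ(0) = ∑ r_j > 0`, so
`φ(0) = α + πm` with `0 < α < π/2`. Counting crossings on both half-lines bounds the numbers of
positive and negative `λ_j` by `p - m` and `q - m`; as `p + q = n` and `φ ≥ 0`, this forces `m = 0`
and equality.

Conversely, if `φ(0) < π/2`, the intermediate value theorem yields `p` positive and `q` negative
crossings. They exhaust the zeros of `Re F`, so every level is met once on each side and the `r_j`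
come out positive. Then `k = ∑ r_j`, and the weights `r_j/k` at the `λ_j` form the spectral measure
of a Jacobi matrix. `F` determines `A` and the `r_j`, hence `k` and all moments, and the moments
determine `J`. -/

theorem eq_of_upperTriangular_of_gram_eq {n : ℕ} {K K' : Matrix (Fin n) (Fin n) ℝ}
    (hK : K.BlockTriangular id) (hK' : K'.BlockTriangular id)
    (hd : ∀ i, 0 < K i i) (hd' : ∀ i, 0 < K' i i) (h : Kᵀ * K = K'ᵀ * K') : K = K' := by
  have hdet : IsUnit K.det := by
    rw [Matrix.det_of_isUpperTriangular hK]
    exact (Finset.prod_ne_zero_iff.2 fun i _ => (hd i).ne').isUnit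
  have : Invertible K := Matrix.invertibleOfIsUnitDet K hdet
  have hKi : K⁻¹.BlockTriangular id := Matrix.blockTriangular_inv_of_blockTriangular hK
  -- `M` is upper triangular and orthogonal, so its inverse `Mᵀ` is triangular both ways: `M` is
  -- diagonal with entries `±1`, and positivity of the diagonals selects `+1`.
  set M := K' * K⁻¹ with hM
  have hMt : M.BlockTriangular id := hK'.mul hKi
  have hMK : M * K = K' := by rw [hM, Matrix.mul_assoc, Matrix.nonsing_inv_mul _ hdet, mul_one]
  have hMM : Mᵀ * M = 1 := by
    have h1 : Mᵀ * M = (K⁻¹)ᵀ * (K'ᵀ * K') * K⁻¹ := by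
      rw [hM, transpose_mul]; simp only [Matrix.mul_assoc]
    rw [h1, ← h, Matrix.mul_assoc, Matrix.mul_assoc, Matrix.mul_nonsing_inv _ hdet, mul_one,
      ← transpose_mul, Matrix.mul_nonsing_inv _ hdet, transpose_one]
  have : Invertible M := invertibleOfLeftInverse M Mᵀ hMM
  have hMi : M⁻¹ = Mᵀ := Matrix.inv_eq_left_inv hMM
  have hMl : Mᵀ.BlockTriangular id := hMi ▸ Matrix.blockTriangular_inv_of_blockTriangular hMt
  have hoff : ∀ i j, i ≠ j → M i j = 0 := fun i j hij => by
    rcases lt_or_gt_of_ne hij with h | h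
    · exact hMl (i := j) (j := i) h
    · exact hMt (i := i) (j := j) h
  have hdiag : ∀ i, M i i = 1 := fun i => by
    have h1 : M i i * K i i = K' i i := by
      rw [← hMK, Matrix.mul_apply, Finset.sum_eq_single i]
      · intro j _ hj; rw [hoff i j hj.symm, zero_mul]
      · simp
    have h2 : M i i * M i i = 1 := by
      have := congrFun (congrFun hMM i) i
      rw [Matrix.mul_apply, Finset.sum_eq_single i] at this
      · simpa using this
      · intro j _ hj; rw [hoff j i hj, mul_zero]
      · simp
    have h3 : 0 < M i i := pos_of_mul_pos_left (h1 ▸ hd' i) (hd i).le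
    nlinarith
  have hM1 : M = 1 := by
    ext i j
    by_cases hij : i = j
    · subst hij; simp [hdiag]
    · simp [hoff i j hij, hij]
  rw [← hMK, hM1, one_mul]

/-- QR factorization: the rows of `U` are the Gram–Schmidt vectors of the columns of `V`, so a
diagonal entry of `U * V` is the norm of the unnormalised vector. -/
theorem exists_orthogonal_mul_upperTriangular {n : ℕ} (V : Matrix (Fin n) (Fin n) ℝ)
    (hV : V.det ≠ 0) : ∃ U : Matrix (Fin n) (Fin n) ℝ, U * Uᵀ = 1 ∧
      (∀ i m, m < i → (U * V) i m = 0) ∧ ∀ i, 0 < (U * V) i i := by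
  let f : Fin n → EuclideanSpace ℝ (Fin n) := fun m => WithLp.toLp 2 (fun j => V j m)
  have hf : LinearIndependent ℝ f := by
    have h1 : LinearIndependent ℝ V.col :=
      Matrix.linearIndependent_cols_iff_isUnit.2 ((Matrix.isUnit_iff_isUnit_det V).2 hV.isUnit)
    exact h1.map' (WithLp.linearEquiv 2 ℝ (Fin n → ℝ)).symm.toLinearMap (LinearEquiv.ker _)
  let e := InnerProductSpace.gramSchmidtNormed ℝ f
  have he : Orthonormal ℝ e := InnerProductSpace.gramSchmidtNormed_orthonormal hf
  have hinner : ∀ x y : EuclideanSpace ℝ (Fin n), inner ℝ x y = ∑ j, x j * y j := fun x y => by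
    simp [PiLp.inner_apply, mul_comm]
  have hUV : (Matrix.of fun i j => e i j) * V = Matrix.of fun i m => inner ℝ (e i) (f m) := by
    ext i m
    simp [hinner, Matrix.mul_apply, f]
  refine ⟨Matrix.of fun i j => e i j, ?_, ?_, ?_⟩
  · ext i j
    have := orthonormal_iff_ite.1 he i j
    rw [hinner] at this
    simp [Matrix.mul_apply, this, Matrix.one_apply]
  · intro i m hm
    rw [hUV]
    simp only [Matrix.of_apply, e, InnerProductSpace.gramSchmidtNormed]
    rw [inner_smul_left, InnerProductSpace.gramSchmidt_inv_triangular ℝ f hm, mul_zero]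
  · intro i
    rw [hUV]
    simp only [Matrix.of_apply, e, InnerProductSpace.gramSchmidtNormed]
    have h0 := InnerProductSpace.gramSchmidt_ne_zero i hf
    have h1 : inner ℝ (InnerProductSpace.gramSchmidt ℝ f i) (f i) =
        ‖InnerProductSpace.gramSchmidt ℝ f i‖ ^ 2 := by
      conv_lhs => rw [InnerProductSpace.gramSchmidt_def'' ℝ f i]
      rw [inner_add_right, inner_sum, Finset.sum_eq_zero, add_zero, real_inner_self_eq_norm_sq]
      intro j hj
      rw [inner_smul_right, InnerProductSpace.gramSchmidt_orthogonal ℝ f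
        (Finset.mem_Iio.1 hj).ne', mul_zero]
    rw [inner_smul_left, h1]
    have := norm_pos_iff.2 h0
    simp
    positivity

/-! ### Jacobi matrices and their spectral data -/

theorem IsJacobi.apply_eq_zero {n : ℕ} {J : Matrix (Fin n) (Fin n) ℝ} (hJ : IsJacobi J)
    {i j : Fin n} (h : (j : ℕ) + 1 < i) : J i j = 0 := by
  rw [hJ.symm]; exact hJ.tridiag j i h

theorem IsJacobi.apply_pos {n : ℕ} {J : Matrix (Fin n) (Fin n) ℝ} (hJ : IsJacobi J)
    {i j : Fin n} (h : (j : ℕ) + 1 = i) : 0 < J i j := by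
  rw [hJ.symm]; exact hJ.offDiag_pos j i h

/-- The matrix whose columns are `e₁, J e₁, J² e₁, …`. -/
def krylov {n : ℕ} [NeZero n] (J : Matrix (Fin n) (Fin n) ℝ) : Matrix (Fin n) (Fin n) ℝ :=
  Matrix.of fun i j => (J ^ (j : ℕ)) i 0

/-- Each application of `J` pushes the last nonzero coordinate one place down and multiplies it by a
positive off-diagonal entry. -/
theorem IsJacobi.pow_apply_zero {n : ℕ} [NeZero n] {J : Matrix (Fin n) (Fin n) ℝ}
    (hJ : IsJacobi J) (m : ℕ) :
    (∀ i : Fin n, m < i → (J ^ m) i 0 = 0) ∧ ∀ i : Fin n, (i : ℕ) = m → 0 < (J ^ m) i 0 := by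
  induction m with
  | zero =>
    refine ⟨fun i hi => ?_, fun i hi => ?_⟩
    · have : i ≠ 0 := by rintro rfl; simp at hi
      simp [this]
    · have : i = 0 := Fin.ext (by simpa using hi)
      simp [this]
  | succ m ih =>
    refine ⟨fun i hi => ?_, fun i hi => ?_⟩
    · rw [pow_succ', Matrix.mul_apply]
      refine Finset.sum_eq_zero fun l _ => ?_
      rcases le_or_gt (l : ℕ) m with h | h
      · rw [hJ.apply_eq_zero (by omega), zero_mul]
      · rw [ih.1 l h, mul_zero]
    · rw [pow_succ', Matrix.mul_apply]
      have hm : m < n := by have := i.2; omega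
      rw [Finset.sum_eq_single ⟨m, hm⟩]
      · exact mul_pos (hJ.apply_pos hi.symm) (ih.2 _ rfl)
      · intro l _ hl
        rcases lt_or_ge m (l : ℕ) with h | h
        · rw [ih.1 l h, mul_zero]
        · have : (l : ℕ) ≠ m := fun h' => hl (Fin.ext h')
          rw [hJ.apply_eq_zero (by omega), zero_mul]
      · simp

theorem IsJacobi.krylov_blockTriangular {n : ℕ} [NeZero n] {J : Matrix (Fin n) (Fin n) ℝ}
    (hJ : IsJacobi J) : (krylov J).BlockTriangular id :=
  fun i j hij => (hJ.pow_apply_zero j).1 i hij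

theorem IsJacobi.krylov_diag_pos {n : ℕ} [NeZero n] {J : Matrix (Fin n) (Fin n) ℝ}
    (hJ : IsJacobi J) (i : Fin n) : 0 < krylov J i i :=
  (hJ.pow_apply_zero i).2 i rfl

theorem IsJacobi.krylov_det_ne_zero {n : ℕ} [NeZero n] {J : Matrix (Fin n) (Fin n) ℝ}
    (hJ : IsJacobi J) : (krylov J).det ≠ 0 := by
  rw [Matrix.det_of_isUpperTriangular hJ.krylov_blockTriangular]
  exact Finset.prod_ne_zero_iff.2 fun i _ => (hJ.krylov_diag_pos i).ne'

/-- Symmetry of `J` gives `⟨Jⁱe₁, Jʲe₁⟩ = ⟨e₁, Jⁱ⁺ʲe₁⟩`, so the Krylov matrix is the Cholesky factor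
of the Hankel matrix of moments. -/
theorem krylov_gram {n : ℕ} [NeZero n] {J : Matrix (Fin n) (Fin n) ℝ} (hJ : IsJacobi J) :
    (krylov J)ᵀ * krylov J = Matrix.of fun i j : Fin n => (J ^ ((i : ℕ) + j)) 0 0 := by
  have hs : Jᵀ = J := Matrix.ext fun i j => hJ.symm j i
  ext i j
  simp only [Matrix.mul_apply, krylov, Matrix.transpose_apply, Matrix.of_apply, pow_add]
  refine Finset.sum_congr rfl fun l _ => ?_
  rw [← Matrix.transpose_apply (J ^ (i : ℕ)), Matrix.transpose_pow, hs]

theorem krylov_gram_mul {n : ℕ} [NeZero n] {J : Matrix (Fin n) (Fin n) ℝ} (hJ : IsJacobi J) :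
    (krylov J)ᵀ * J * krylov J =
      Matrix.of fun i j : Fin n => (J ^ ((i : ℕ) + (j + 1))) 0 0 := by
  have hs : Jᵀ = J := Matrix.ext fun i j => hJ.symm j i
  ext i j
  simp only [Matrix.mul_assoc, Matrix.of_apply, pow_add _ (i : ℕ), pow_succ' J j]
  rw [Matrix.mul_apply, Matrix.mul_apply (M := J ^ (i : ℕ))]
  refine Finset.sum_congr rfl fun l _ => ?_
  rw [← Matrix.transpose_apply (J ^ (i : ℕ)), Matrix.transpose_pow, hs]
  simp [Matrix.mul_apply, krylov]

/-- A Jacobi matrix is determined by the moments of its spectral measure at `e₁`. -/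
theorem IsJacobi.eq_of_moments_eq {n : ℕ} [NeZero n] {J J' : Matrix (Fin n) (Fin n) ℝ}
    (hJ : IsJacobi J) (hJ' : IsJacobi J') (h : ∀ m, (J ^ m) 0 0 = (J' ^ m) 0 0) : J = J' := by
  have hK : krylov J = krylov J' :=
    eq_of_upperTriangular_of_gram_eq hJ.krylov_blockTriangular hJ'.krylov_blockTriangular
      hJ.krylov_diag_pos hJ'.krylov_diag_pos (by rw [krylov_gram hJ, krylov_gram hJ']; simp [h])
  have h2 : (krylov J)ᵀ * J * krylov J = (krylov J)ᵀ * J' * krylov J := by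
    conv_rhs => rw [hK]
    rw [krylov_gram_mul hJ, krylov_gram_mul hJ']; simp [h]
  have hu : IsUnit (krylov J) :=
    (Matrix.isUnit_iff_isUnit_det _).2 hJ.krylov_det_ne_zero.isUnit
  have hu' : IsUnit (krylov J)ᵀ :=
    (Matrix.isUnit_iff_isUnit_det _).2 (by rw [det_transpose]; exact hJ.krylov_det_ne_zero.isUnit)
  exact hu'.mul_left_cancel (hu.mul_right_cancel h2)

theorem conj_diagonal_pow {n : ℕ} {U : Matrix (Fin n) (Fin n) ℝ} (hU : U * Uᵀ = 1)
    (lam : Fin n → ℝ) (m : ℕ) :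
    (U * diagonal lam * Uᵀ) ^ m = U * diagonal (fun j => lam j ^ m) * Uᵀ := by
  have hU' : Uᵀ * U = 1 := mul_eq_one_comm.1 hU
  induction m with
  | zero => simp [hU]
  | succ m ih =>
    rw [pow_succ, ih]
    calc _ = U * (diagonal (fun j => lam j ^ m) * (Uᵀ * U) * diagonal lam) * Uᵀ := by
          simp only [Matrix.mul_assoc]
      _ = _ := by rw [hU', mul_one, diagonal_mul_diagonal]; simp [pow_succ]

theorem conj_diagonal_apply {n : ℕ} (U : Matrix (Fin n) (Fin n) ℝ) (lam : Fin n → ℝ)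
    (i l : Fin n) : (U * diagonal lam * Uᵀ) i l = ∑ j, U i j * lam j * U l j := by
  rw [Matrix.mul_apply]
  simp only [Matrix.mul_diagonal, Matrix.transpose_apply]

/-- In an eigenbasis the Krylov matrix factors as `U diag(U 0) V(λ)` with `V(λ)` Vandermonde. Its
invertibility forces both the simplicity of the spectrum and the nonvanishing of the first
components. -/
theorem IsJacobi.exists_spectral_data {n : ℕ} [NeZero n] {J : Matrix (Fin n) (Fin n) ℝ}
    (hJ : IsJacobi J) : ∃ (U : Matrix (Fin n) (Fin n) ℝ) (lam : Fin n → ℝ), U * Uᵀ = 1 ∧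
      J = U * diagonal lam * Uᵀ ∧ Function.Injective lam ∧ ∀ j, U 0 j ≠ 0 := by
  have hH : J.IsHermitian := by
    ext i j; simp [hJ.symm j i]
  have hspec := hH.spectral_theorem
  rw [Unitary.conjStarAlgAut_apply] at hspec
  set U : Matrix (Fin n) (Fin n) ℝ := (hH.eigenvectorUnitary : Matrix (Fin n) (Fin n) ℝ)
  have hU : U * Uᵀ = 1 := by
    have := Unitary.mul_star_self_of_mem hH.eigenvectorUnitary.2
    rwa [Matrix.star_eq_conjTranspose, Matrix.conjTranspose_eq_transpose_of_trivial] at this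
  have hJU : J = U * diagonal hH.eigenvalues * Uᵀ := by
    rw [Matrix.star_eq_conjTranspose, Matrix.conjTranspose_eq_transpose_of_trivial] at hspec
    exact hspec
  have hK : krylov J = U * diagonal (U 0) * vandermonde hH.eigenvalues := by
    ext i m
    simp only [krylov, Matrix.of_apply]
    conv_lhs => rw [hJU]
    rw [conj_diagonal_pow hU, conj_diagonal_apply, Matrix.mul_apply]
    refine Finset.sum_congr rfl fun j _ => ?_
    rw [Matrix.mul_diagonal, vandermonde_apply]; ring
  have hdet := hJ.krylov_det_ne_zero
  rw [hK, det_mul, det_mul, det_diagonal] at hdet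
  exact ⟨U, hH.eigenvalues, hU, hJU, det_vandermonde_ne_zero_iff.1 (right_ne_zero_of_mul hdet),
    fun j => Finset.prod_ne_zero_iff.1 (right_ne_zero_of_mul (left_ne_zero_of_mul hdet)) j
      (Finset.mem_univ j)⟩

/-- Every finitely supported spectral measure is the spectral measure of a Jacobi matrix. -/
theorem exists_isJacobi_of_spectral_data {n : ℕ} [NeZero n] {lam v : Fin n → ℝ}
    (hlam : Function.Injective lam) (hv : ∀ j, v j ≠ 0) (hsum : ∑ j, v j ^ 2 = 1) :
    ∃ U : Matrix (Fin n) (Fin n) ℝ, U * Uᵀ = 1 ∧ (∀ j, U 0 j ^ 2 = v j ^ 2) ∧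
      IsJacobi (U * diagonal lam * Uᵀ) := by
  -- The columns of `V` are the Krylov vectors `v, Λv, Λ²v, …` of `Λ = diag(λ)`. In the basis
  -- obtained by orthonormalising them `Λ` becomes tridiagonal.
  set V := diagonal v * vandermonde lam with hV
  have hdet : V.det ≠ 0 := by
    rw [hV, det_mul, det_diagonal]
    exact mul_ne_zero (Finset.prod_ne_zero_iff.2 fun j _ => hv j)
      (det_vandermonde_ne_zero_iff.2 hlam)
  obtain ⟨U, hU, htri, hpos⟩ := exists_orthogonal_mul_upperTriangular V hdet
  have hU' : Uᵀ * U = 1 := mul_eq_one_comm.1 hU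
  set R := U * V with hR
  set J := U * diagonal lam * Uᵀ with hJdef
  have hsymm : ∀ i j, J i j = J j i := fun i j => by
    rw [hJdef, conj_diagonal_apply, conj_diagonal_apply]
    exact Finset.sum_congr rfl fun l _ => by ring
  have hJR : J * R = U * (diagonal lam * V) := by
    rw [hJdef, hR]
    calc _ = U * diagonal lam * (Uᵀ * U) * V := by simp only [Matrix.mul_assoc]
      _ = _ := by rw [hU', mul_one, Matrix.mul_assoc]
  have hJRa : ∀ i m m' : Fin n, (m : ℕ) + 1 = m' → (J * R) i m = R i m' := by
    intro i m m' h
    rw [hJR, hR, Matrix.mul_apply, Matrix.mul_apply]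
    refine Finset.sum_congr rfl fun j _ => ?_
    rw [hV, diagonal_mul, diagonal_mul, diagonal_mul, vandermonde_apply, vandermonde_apply, ← h]
    ring
  -- `J` sends column `l` of `R` to column `l + 1`, which vanishes at `i`. The earlier columns of
  -- `J` vanish at `i` by induction, so only `J i l * R l l` is left, and `R l l > 0`.
  have hcol : ∀ m : ℕ, ∀ (l i : Fin n), (l : ℕ) = m → m + 1 < i → J i l = 0 := by
    intro m
    induction m using Nat.strong_induction_on with
    | _ m ih =>
      intro l i hl hi
      have h1 : (l : ℕ) + 1 < n := by have := i.2; omega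
      have h2 := hJRa i l ⟨l + 1, h1⟩ rfl
      rw [htri i _ (by rw [Fin.lt_def]; simp; omega), Matrix.mul_apply,
        Finset.sum_eq_single l] at h2
      · exact (mul_eq_zero.1 h2).resolve_right (hpos l).ne'
      · intro p _ hp
        rcases lt_or_gt_of_ne hp with h | h
        · rw [Fin.lt_def] at h
          rw [ih p (by omega) p i rfl (by omega), zero_mul]
        · rw [htri p l h, mul_zero]
      · simp
  refine ⟨U, hU, ?_, ⟨hsymm, ?_, ?_⟩⟩
  · have h1 : ∀ j, v j = U 0 j * R 0 0 := by
      intro j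
      have h2 : Uᵀ * R = V := by rw [hR, ← Matrix.mul_assoc, hU', one_mul]
      have h3 := congrFun (congrFun h2 j) 0
      rw [Matrix.mul_apply, Finset.sum_eq_single 0, hV, diagonal_mul, vandermonde_apply] at h3
      · simpa using h3.symm
      · intro p _ hp
        rw [htri p 0 (Fin.pos_iff_ne_zero.2 hp), mul_zero]
      · simp
    have h2 : ∑ j, U 0 j ^ 2 = 1 := by
      have := congrFun (congrFun hU 0) 0
      rw [Matrix.mul_apply] at this
      simpa [sq] using this
    have h3 : R 0 0 ^ 2 = 1 := by
      rw [← hsum, ← one_mul (R 0 0 ^ 2), ← h2, Finset.sum_mul]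
      exact Finset.sum_congr rfl fun j _ => by rw [h1 j]; ring
    intro j
    rw [h1 j, mul_pow, h3, mul_one]
  · intro i j hij
    have h2 := hJRa j i j hij
    rw [Matrix.mul_apply, Finset.sum_eq_single i] at h2
    · refine lt_of_lt_of_eq ?_ (hsymm j i)
      exact pos_of_mul_pos_left (h2 ▸ hpos j) (hpos i).le
    · intro p _ hp
      rcases lt_or_gt_of_ne hp with h | h
      · rw [Fin.lt_def] at h
        rw [hcol p p j rfl (by omega), zero_mul]
      · rw [htri p i h, mul_zero]
    · simp
  · intro i j hij
    exact (hsymm i j).trans (hcol i i j rfl hij)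

/-! ### The characteristic polynomial in terms of spectral data -/

/-- The real polynomial `∑ j, c j ∏_{i ≠ j} (X - lam i)`, the numerator of
`∑ j, c j / (X - lam j)`. -/
noncomputable def residuePoly {n : ℕ} (lam c : Fin n → ℝ) : ℝ[X] :=
  ∑ j, C (c j) * Lagrange.nodal (Finset.univ.erase j) lam

/-- The polynomial `∏ j, (X - lam j)` minus `i` times the numerator of
`∑ j, lam j * r j / (X - lam j)`. -/
noncomputable def spectralPoly {n : ℕ} (lam r : Fin n → ℝ) : ℂ[X] :=
  (Lagrange.nodal Finset.univ lam).map Complex.ofRealHom -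
    C Complex.I * (residuePoly lam fun j => lam j * r j).map Complex.ofRealHom

theorem eval_map_ofRealHom (p : ℝ[X]) (x : ℝ) :
    (p.map Complex.ofRealHom).eval (x : ℂ) = ((p.eval x : ℝ) : ℂ) := by
  rw [← Complex.ofRealHom_eq_coe, Polynomial.eval_map_apply, Complex.ofRealHom_eq_coe]

theorem spectralPoly_eval {n : ℕ} (lam r : Fin n → ℝ) (x : ℝ) :
    (spectralPoly lam r).eval (x : ℂ) = ((Lagrange.nodal Finset.univ lam).eval x : ℝ) -
      Complex.I * ((residuePoly lam fun j => lam j * r j).eval x : ℝ) := by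
  simp only [spectralPoly, eval_sub, eval_mul, eval_C, eval_map_ofRealHom]

theorem spectralPoly_eval_re {n : ℕ} (lam r : Fin n → ℝ) (x : ℝ) :
    ((spectralPoly lam r).eval (x : ℂ)).re = (Lagrange.nodal Finset.univ lam).eval x := by
  simp [spectralPoly_eval]

theorem spectralPoly_eval_im {n : ℕ} (lam r : Fin n → ℝ) (x : ℝ) :
    ((spectralPoly lam r).eval (x : ℂ)).im =
      -(residuePoly lam fun j => lam j * r j).eval x := by
  simp [spectralPoly_eval]

theorem residuePoly_eval_node {n : ℕ} (lam c : Fin n → ℝ) (j : Fin n) :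
    (residuePoly lam c).eval (lam j) =
      c j * (Lagrange.nodal Finset.univ lam).derivative.eval (lam j) := by
  rw [Lagrange.eval_nodal_derivative_eval_node_eq (Finset.mem_univ j), residuePoly,
    eval_finsetSum, Finset.sum_eq_single j]
  · simp
  · intro i _ hij
    rw [eval_mul, Lagrange.eval_nodal_at_node (Finset.mem_erase.2 ⟨hij.symm, Finset.mem_univ j⟩),
      mul_zero]
  · simp

theorem derivative_nodal_eval_ne_zero {n : ℕ} {lam : Fin n → ℝ} (hlam : Function.Injective lam)
    (j : Fin n) : (Lagrange.nodal Finset.univ lam).derivative.eval (lam j) ≠ 0 := by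
  rw [Lagrange.eval_nodal_derivative_eval_node_eq (Finset.mem_univ j)]
  rw [Lagrange.eval_nodal]
  exact Finset.prod_ne_zero_iff.2 fun i hi =>
    sub_ne_zero.2 (hlam.ne (Finset.ne_of_mem_erase hi).symm)

theorem degree_C_mul_le_degree {R : Type*} [Semiring R] (a : R) (p : R[X]) :
    (C a * p).degree ≤ p.degree :=
  (degree_mul_le _ _).trans ((add_le_add_left degree_C_le _).trans_eq (zero_add _))

theorem residuePoly_degree_lt {n : ℕ} (lam c : Fin n → ℝ) : (residuePoly lam c).degree < n := by
  refine lt_of_le_of_lt (degree_sum_le _ _) ((Finset.sup_lt_iff (WithBot.bot_lt_coe n)).2 ?_)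
  intro j _
  refine lt_of_le_of_lt (degree_C_mul_le_degree _ _) ?_
  rw [Lagrange.degree_nodal, Finset.card_erase_of_mem (Finset.mem_univ j), Finset.card_univ,
    Fintype.card_fin]
  have := j.2
  exact Nat.cast_lt.2 (by omega)

theorem spectralPoly_degree_sub_lt {n : ℕ} (lam r : Fin n → ℝ) :
    (spectralPoly lam r - (Lagrange.nodal Finset.univ lam).map Complex.ofRealHom).degree < n := by
  rw [spectralPoly, sub_sub_cancel_left, degree_neg]
  refine lt_of_le_of_lt (degree_C_mul_le_degree _ _) (lt_of_le_of_lt degree_map_le ?_)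
  exact residuePoly_degree_lt _ _

theorem charpoly_conj_of_mul_eq_one {R : Type*} [CommRing R] {n : ℕ} {M N : Matrix (Fin n) (Fin n) R}
    (h : M * N = 1) (A : Matrix (Fin n) (Fin n) R) : (M * A * N).charpoly = A.charpoly := by
  rw [charpoly_mul_comm, ← Matrix.mul_assoc, mul_eq_one_comm.1 h, one_mul]

theorem charpoly_conj_diagonal {n : ℕ} {U : Matrix (Fin n) (Fin n) ℝ} (hU : U * Uᵀ = 1)
    (lam : Fin n → ℝ) :
    (U * diagonal lam * Uᵀ).charpoly = Lagrange.nodal Finset.univ lam := by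
  rw [charpoly_conj_of_mul_eq_one hU, charpoly_diagonal]; rfl

/-- The matrix determinant lemma, multiplied out so that no inverses remain. -/
theorem det_diagonal_add_vecMulVec {K : Type*} [Field K] {n : ℕ} {d : Fin n → K}
    (hd : ∀ j, d j ≠ 0) (u w : Fin n → K) :
    (diagonal d + vecMulVec u w).det =
      ∏ j, d j + ∑ j, u j * w j * ∏ i ∈ Finset.univ.erase j, d i := by
  have hu : IsUnit (diagonal d).det := by
    rw [det_diagonal]
    exact (Finset.prod_ne_zero_iff.2 fun j _ => hd j).isUnit
  rw [vecMulVec_eq Unit, det_add_replicateCol_mul_replicateRow hu, det_diagonal,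
    det_unique]
  have hinv : (diagonal d)⁻¹ = diagonal (fun j => (d j)⁻¹) := by
    refine Matrix.inv_eq_left_inv ?_
    rw [diagonal_mul_diagonal, ← diagonal_one]
    congr 1
    ext j
    exact inv_mul_cancel₀ (hd j)
  rw [hinv, Matrix.add_apply, one_apply_eq, mul_add, mul_one, Matrix.mul_apply, Finset.mul_sum]
  congr 1
  refine Finset.sum_congr rfl fun j _ => ?_
  rw [Matrix.mul_diagonal, ← Finset.mul_prod_erase _ _ (Finset.mem_univ j)]
  simp only [replicateRow_apply, replicateCol_apply]
  field_simp [hd j]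

theorem charpoly_multPerturb {n : ℕ} [NeZero n] {U : Matrix (Fin n) (Fin n) ℝ}
    (hU : U * Uᵀ = 1) (lam : Fin n → ℝ) (k : ℝ) :
    (multPerturb (U * diagonal lam * Uᵀ) k).charpoly =
      spectralPoly lam (fun j => k * U 0 j ^ 2) := by
  set W : Matrix (Fin n) (Fin n) ℂ := U.map Complex.ofRealHom with hW
  have hWW : W * Wᵀ = 1 := by
    rw [hW, ← transpose_map, ← Matrix.map_mul, hU, Matrix.map_one _ (map_zero _) (map_one _)]
  have hWE : vecMulVec (W 0) (W 0) * Wᵀ = Wᵀ * Matrix.single 0 0 1 := by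
    have h1 : vecMulVec (W 0) (W 0) = Wᵀ * Matrix.single 0 0 1 * W := by
      ext i j
      rw [Matrix.mul_assoc, Matrix.mul_apply, Finset.sum_eq_single 0]
      · simp [vecMulVec_apply]
      · intro l _ hl
        simp [Matrix.single_mul_apply_of_ne, hl]
      · simp
    rw [h1, Matrix.mul_assoc, hWW, mul_one]
  set D : Matrix (Fin n) (Fin n) ℂ := diagonal fun j => (lam j : ℂ) with hD
  have hT : multPerturb (U * diagonal lam * Uᵀ) k =
      W * (D * (1 + (Complex.I * k) • vecMulVec (W 0) (W 0))) * Wᵀ := by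
    have h1 : (U * diagonal lam * Uᵀ).map Complex.ofReal = W * D * Wᵀ := by
      change (U * diagonal lam * Uᵀ).map Complex.ofRealHom = _
      rw [Matrix.map_mul, Matrix.map_mul, diagonal_map (map_zero _), ← transpose_map]
      rfl
    have h2 : W * (D * vecMulVec (W 0) (W 0)) * Wᵀ = W * D * Wᵀ * Matrix.single 0 0 1 := by
      rw [Matrix.mul_assoc W, Matrix.mul_assoc D, hWE]
      simp only [Matrix.mul_assoc]
    rw [multPerturb, h1]
    rw [mul_add, mul_add, mul_add, add_mul, mul_one, mul_one, Matrix.mul_smul, Matrix.mul_smul,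
      Matrix.mul_smul, Matrix.smul_mul, h2]
  have hch : (multPerturb (U * diagonal lam * Uᵀ) k).charpoly =
      (D * (1 + (Complex.I * k) • vecMulVec (W 0) (W 0))).charpoly := by
    rw [hT, charpoly_conj_of_mul_eq_one hWW]
  rw [hch]
  -- It suffices to compare values off the finite set of the `λ_j`, where the diagonal part is
  -- invertible and the rank-one determinant formula applies.
  refine Polynomial.eq_of_infinite_eval_eq _ _ (Set.Infinite.mono ?_
    (Set.finite_range fun j => (lam j : ℂ)).infinite_compl)
  intro z hz
  have hz' : ∀ j, z - lam j ≠ 0 := fun j h => hz ⟨j, (sub_eq_zero.1 h).symm⟩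
  rw [Set.mem_ofPred_eq, Matrix.eval_charpoly]
  have h1 : scalar (Fin n) z - D * (1 + (Complex.I * k) • vecMulVec (W 0) (W 0)) =
      diagonal (fun j => z - lam j) +
        vecMulVec (fun j => -(Complex.I * k * lam j * W 0 j)) (W 0) := by
    ext i j
    rw [Matrix.sub_apply, Matrix.add_apply, mul_add, mul_one, Matrix.add_apply, hD, diagonal_mul,
      Matrix.smul_apply, vecMulVec_apply, vecMulVec_apply, Matrix.scalar_apply, smul_eq_mul]
    simp only [diagonal_apply]
    split_ifs <;> ring
  rw [h1, det_diagonal_add_vecMulVec hz', spectralPoly]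
  simp only [residuePoly, Lagrange.nodal, eval_sub, eval_mul, eval_C, Polynomial.map_sum,
    Polynomial.map_mul, Polynomial.map_prod, Polynomial.map_sub, map_X, map_C, eval_finsetSum,
    eval_prod, eval_X, Complex.ofRealHom_eq_coe, Finset.mul_sum]
  rw [sub_eq_add_neg, ← Finset.sum_neg_distrib]
  congr 1
  refine Finset.sum_congr rfl fun j _ => ?_
  simp only [hW, map_apply, Complex.ofRealHom_eq_coe]
  push_cast
  ring

/-! ### Phase of a polynomial without real zeros along the real line -/

/-- The sum over `z ∈ Z` of the arguments modulo `π` of `z - x`, written through `arctan` so that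
it is visibly continuous in `x`. -/
noncomputable def phase (Z : Multiset ℂ) (x : ℝ) : ℝ :=
  (Z.map fun z => Real.pi / 2 - Real.arctan ((z.re - x) / z.im)).sum

@[simp] theorem phase_zero_left (x : ℝ) : phase 0 x = 0 := by simp [phase]

@[simp] theorem phase_cons (z : ℂ) (Z : Multiset ℂ) (x : ℝ) :
    phase (z ::ₘ Z) x = (Real.pi / 2 - Real.arctan ((z.re - x) / z.im)) + phase Z x := by
  simp [phase]

theorem continuous_phase (Z : Multiset ℂ) : Continuous (phase Z) := by
  induction Z using Multiset.induction_on with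
  | empty => exact (continuous_const (y := (0 : ℝ))).congr fun x => (phase_zero_left x).symm
  | cons z Z ih =>
    refine Continuous.congr ?_ fun x => (phase_cons z Z x).symm
    refine Continuous.add ?_ ih
    exact continuous_const.sub
      (Real.continuous_arctan.comp ((continuous_const.sub continuous_id).div_const _))

theorem phase_nonneg (Z : Multiset ℂ) (x : ℝ) : 0 ≤ phase Z x := by
  refine Multiset.sum_nonneg fun t ht => ?_
  obtain ⟨z, _, rfl⟩ := Multiset.mem_map.1 ht
  linarith [Real.arctan_lt_pi_div_two ((z.re - x) / z.im)]

theorem phase_map_neg (Z : Multiset ℂ) (x : ℝ) : phase (Z.map fun z => -z) x = phase Z (-x) := by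
  rw [phase, phase, Multiset.map_map]
  congr 1
  refine Multiset.map_congr rfl fun z _ => ?_
  simp only [Function.comp, Complex.neg_re, Complex.neg_im]
  rw [← neg_div_neg_eq (-z.re - x), neg_neg]
  congr 3
  ring

/-- The real factor carries the sign of `Im z`, so that one formula with an angle in `(0, π)` serves
both half-planes. -/
theorem eq_mul_exp_phase {z : ℂ} (hz : z.im ≠ 0) :
    z = ((z.im * √(1 + (z.re / z.im) ^ 2) : ℝ) : ℂ) *
      Complex.exp (Complex.I * ((Real.pi / 2 - Real.arctan (z.re / z.im) : ℝ) : ℂ)) := by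
  have hs : √(1 + (z.re / z.im) ^ 2) ≠ 0 := (Real.sqrt_pos.2 (by positivity)).ne'
  rw [mul_comm Complex.I, Complex.exp_mul_I, ← Complex.ofReal_cos, ← Complex.ofReal_sin,
    Real.cos_pi_div_two_sub, Real.sin_pi_div_two_sub, Real.sin_arctan, Real.cos_arctan]
  apply Complex.ext
  · rw [Complex.re_ofReal_mul]
    simp
    field_simp
  · rw [Complex.im_ofReal_mul]
    simp
    field_simp

theorem argModPi_eq {z : ℂ} (hz : z.im ≠ 0) :
    argModPi z = Real.pi / 2 - Real.arctan (z.re / z.im) := by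
  have h1 := Real.arctan_lt_pi_div_two (z.re / z.im)
  have h2 := Real.neg_pi_div_two_lt_arctan (z.re / z.im)
  have hs : 0 < √(1 + (z.re / z.im) ^ 2) := Real.sqrt_pos.2 (by positivity)
  have hpolar := eq_mul_exp_phase hz
  set t := Real.pi / 2 - Real.arctan (z.re / z.im) with ht
  rw [mul_comm Complex.I, Complex.exp_mul_I] at hpolar
  rcases lt_or_gt_of_ne hz with h | h
  · rw [argModPi, if_neg h.not_gt, if_pos h]
    have h3 : z = ((-z.im * √(1 + (z.re / z.im) ^ 2) : ℝ) : ℂ) *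
        (Complex.cos ((t - Real.pi : ℝ) : ℂ) + Complex.sin ((t - Real.pi : ℝ) : ℂ) * Complex.I) := by
      rw [Complex.ofReal_sub, Complex.cos_sub_pi, Complex.sin_sub_pi]
      conv_lhs => rw [hpolar]
      push_cast
      ring
    have h4 : Complex.arg z = t - Real.pi := by
      conv_lhs => rw [h3]
      exact Complex.arg_mul_cos_add_sin_mul_I (mul_pos (neg_pos.2 h) hs)
        ⟨by linarith, by linarith⟩
    rw [h4]; ring
  · rw [argModPi, if_pos h]
    conv_lhs => rw [hpolar]
    exact Complex.arg_mul_cos_add_sin_mul_I (mul_pos h hs) ⟨by linarith, by linarith⟩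

theorem sum_argModPi_eq_phase {Z : Multiset ℂ} (hZ : ∀ z ∈ Z, z.im ≠ 0) :
    (Z.map argModPi).sum = phase Z 0 := by
  rw [phase]
  congr 1
  refine Multiset.map_congr rfl fun z hz => ?_
  rw [argModPi_eq (hZ z hz), sub_zero]

theorem prod_sub_eq_mul_exp_phase {Z : Multiset ℂ} (hZ : ∀ z ∈ Z, z.im ≠ 0) :
    ∃ ρ : ℝ → ℝ, (∀ x y, 0 < ρ x * ρ y) ∧ ∀ x : ℝ, (Z.map fun z => (x : ℂ) - z).prod =
      ρ x * Complex.exp (Complex.I * (phase Z x : ℂ)) := by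
  induction Z using Multiset.induction_on with
  | empty => exact ⟨fun _ => 1, fun _ _ => by norm_num, fun x => by simp⟩
  | cons z Z ih =>
    obtain ⟨ρ, hρ, h⟩ := ih fun w hw => hZ w (Multiset.mem_cons_of_mem hw)
    have hz := hZ z (Multiset.mem_cons_self z Z)
    refine ⟨fun x => -(z.im * √(1 + ((z.re - x) / z.im) ^ 2)) * ρ x, fun x y => ?_, fun x => ?_⟩
    · have hs : ∀ x : ℝ, 0 < √(1 + ((z.re - x) / z.im) ^ 2) :=
        fun x => Real.sqrt_pos.2 (by positivity)
      have : 0 < z.im ^ 2 := by positivity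
      calc 0 < z.im ^ 2 * √(1 + ((z.re - x) / z.im) ^ 2) * √(1 + ((z.re - y) / z.im) ^ 2) *
            (ρ x * ρ y) := mul_pos (mul_pos (mul_pos this (hs x)) (hs y)) (hρ x y)
        _ = _ := by ring
    · have hzx : (z - x).im ≠ 0 := by simpa using hz
      have h1 := eq_mul_exp_phase hzx
      simp only [Complex.sub_re, Complex.sub_im, Complex.ofReal_re, Complex.ofReal_im,
        sub_zero] at h1
      rw [Multiset.map_cons, Multiset.prod_cons, h, phase_cons, Complex.ofReal_add, mul_add,
        Complex.exp_add, ← neg_sub z, h1]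
      push_cast
      ring

theorem tendsto_phase_atTop {Z : Multiset ℂ} (hZ : ∀ z ∈ Z, z.im ≠ 0) :
    Filter.Tendsto (phase Z) Filter.atTop
      (𝓝 (Real.pi * (Z.countP fun z => 0 < z.im : ℕ))) := by
  induction Z using Multiset.induction_on with
  | empty => simp [funext phase_zero_left]
  | cons z Z ih =>
    have ih := ih fun w hw => hZ w (Multiset.mem_cons_of_mem hw)
    have hz := hZ z (Multiset.mem_cons_self z Z)
    have hlin : Filter.Tendsto (fun x : ℝ => z.re - x) Filter.atTop Filter.atBot :=
      Filter.tendsto_atBot_add_const_left _ _ Filter.tendsto_neg_atTop_atBot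
    rw [show phase (z ::ₘ Z) = fun x => (Real.pi / 2 - Real.arctan ((z.re - x) / z.im)) +
      phase Z x from funext (phase_cons z Z), Multiset.countP_cons]
    push_cast
    rw [mul_add, add_comm]
    refine Filter.Tendsto.add ?_ ih
    rcases lt_or_gt_of_ne hz with h | h
    · rw [if_neg h.not_gt]
      have h1 := (Real.tendsto_arctan_atTop.mono_right nhdsWithin_le_nhds).comp
        ((Filter.tendsto_div_const_atTop_of_neg h).2 hlin)
      simpa using h1.const_sub (Real.pi / 2)
    · rw [if_pos h]
      have h1 := (Real.tendsto_arctan_atBot.mono_right nhdsWithin_le_nhds).comp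
        (hlin.atBot_div_const h)
      simpa using h1.const_sub (Real.pi / 2)

theorem tendsto_phase_neg_atTop {Z : Multiset ℂ} (hZ : ∀ z ∈ Z, z.im ≠ 0) :
    Filter.Tendsto (fun x => phase Z (-x)) Filter.atTop
      (𝓝 (Real.pi * (Z.countP fun z => z.im < 0 : ℕ))) := by
  have h : ∀ z ∈ Z.map fun z => -z, z.im ≠ 0 := fun z hz => by
    obtain ⟨w, hw, rfl⟩ := Multiset.mem_map.1 hz
    simpa using hZ w hw
  have h1 := tendsto_phase_atTop h
  rw [Multiset.countP_map, ← Multiset.countP_eq_card_filter] at h1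
  simpa [funext (phase_map_neg Z)] using h1

theorem countP_im_add_countP_im {Z : Multiset ℂ} (hZ : ∀ z ∈ Z, z.im ≠ 0) :
    Z.countP (fun z => 0 < z.im) + Z.countP (fun z => z.im < 0) = Z.card := by
  rw [Multiset.card_eq_countP_add_countP (fun z : ℂ => 0 < z.im)]
  congr 1
  refine Multiset.countP_congr rfl fun z hz => ?_
  have := hZ z hz
  simp only [not_lt, eq_iff_iff]
  exact ⟨le_of_lt, fun h => lt_of_le_of_ne h this⟩

/-! ### Level crossings of a continuous function -/

/-- The function `f` is below `f a` just before `a` and above `f a` just after `a`. -/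
def CrossesUpAt (f : ℝ → ℝ) (a : ℝ) : Prop :=
  (∀ᶠ x in 𝓝[<] a, f x < f a) ∧ ∀ᶠ x in 𝓝[>] a, f a < f x

/-- At the first return `c` to the level, `f` would lie above it just before `c`, which an upward
crossing at `c` excludes. -/
theorem lt_of_crossesUpAt {f : ℝ → ℝ} (hf : Continuous f) {a : ℝ}
    (h : ∀ x, a ≤ x → f x = f a → CrossesUpAt f x) {b : ℝ} (hab : a < b) : f a < f b := by
  by_contra! hb
  obtain ⟨ε, hε, hε'⟩ : ∃ ε > a, ∀ x ∈ Set.Ioo a ε, f a < f x := by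
    obtain ⟨ε, hε, h'⟩ := mem_nhdsGT_iff_exists_Ioo_subset.1 (h a le_rfl rfl).2
    exact ⟨ε, hε, fun x hx => h' hx⟩
  have hεb : ε ≤ b := by
    by_contra! hlt
    exact absurd (hε' b ⟨hab, hlt⟩) hb.not_gt
  obtain ⟨c, ⟨⟨hc1, hc2⟩, hc3⟩, hc4⟩ := (isCompact_Icc (a := ε) (b := b)).inter_right
    (isClosed_le hf continuous_const : IsClosed {x | f x ≤ f a}) |>.exists_isLeast
      ⟨b, ⟨hεb, le_rfl⟩, hb⟩
  have hac : a < c := lt_of_lt_of_le hε hc1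
  have hbelow : ∀ x ∈ Set.Ioo a c, f a < f x := by
    intro x hx
    rcases lt_or_ge x ε with h1 | h1
    · exact hε' x ⟨hx.1, h1⟩
    · by_contra! h2
      exact absurd (hc4 ⟨⟨h1, hx.2.le.trans hc2⟩, h2⟩) hx.2.not_ge
  have hev : ∀ᶠ x in 𝓝[<] c, f a < f x :=
    Filter.mem_of_superset (Ioo_mem_nhdsLT hac) hbelow
  have hfc : f c = f a := by
    refine le_antisymm hc3 (ge_of_tendsto (hf.continuousWithinAt (s := Set.Iio c) (x := c)) ?_)
    exact hev.mono fun x hx => hx.le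
  obtain ⟨x, hx1, hx2⟩ := (hev.and (h c hac.le hfc).1).exists
  linarith

theorem lt_of_crossesUpAt' {f : ℝ → ℝ} (hf : Continuous f) {a b : ℝ} (hba : b < a)
    (h : ∀ x, b ≤ x → f x = f a → CrossesUpAt f x) : f b < f a := by
  by_contra! hb
  -- Just left of `a` the function is below the level, so from `f b` it must have come down through
  -- the level at some `c`. After `c`, however, it stays above.
  obtain ⟨x, hx1, hx2⟩ := ((h a hba.le rfl).1.and (Ioo_mem_nhdsLT hba)).exists
  obtain ⟨c, hc, hc'⟩ := intermediate_value_Ico' hx2.1.le hf.continuousOn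
    (show f a ∈ Set.Ioc (f x) (f b) from ⟨hx1, hb⟩)
  have := lt_of_crossesUpAt hf (a := c) (fun x hx hxe => h x (hc.1.trans hx) (hxe.trans hc'))
    (hc.2.trans hx2.2)
  linarith

theorem exists_ge_eq_of_tendsto {f : ℝ → ℝ} (hf : Continuous f) {l L a : ℝ}
    (hlim : Filter.Tendsto f Filter.atTop (𝓝 l)) (ha : f a ≤ L) (hL : L < l) :
    ∃ x, a ≤ x ∧ f x = L := by
  obtain ⟨b, hb1, hb2⟩ :=
    ((hlim.eventually (lt_mem_nhds hL)).and (Filter.eventually_ge_atTop a)).exists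
  obtain ⟨x, hx, hx'⟩ := intermediate_value_Icc hb2 hf.continuousOn ⟨ha, hb1.le⟩
  exact ⟨x, hx.1, hx'⟩

theorem eventually_abs_sub_lt_pi {f : ℝ → ℝ} (hf : Continuous f) (a : ℝ) :
    ∀ᶠ x in 𝓝 a, |f x - f a| < Real.pi := by
  have h : Filter.Tendsto (fun x => |f x - f a|) (𝓝 a) (𝓝 |f a - f a|) :=
    ((hf.sub continuous_const).abs).tendsto a
  exact h.eventually (gt_mem_nhds (by simp [Real.pi_pos]))

/-- Near `a` the difference `f x - f a` is less than `π` in size, so it has the sign of its sine,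
hence of `g`. No derivative of `f` is needed. -/
theorem crossesUpAt_of_sin {f g : ℝ → ℝ} {a g' : ℝ} (hf : Continuous f)
    (hg : HasDerivAt g g' a) (hg' : 0 < g') (hga : g a = 0)
    (h : ∀ x, ∃ c > 0, g x = c * Real.sin (f x - f a)) : CrossesUpAt f a := by
  have h1 := eventually_nhdsWithin_sign_eq_of_deriv_pos (by rwa [hg.deriv]) hga
  have h2 := h1.and (eventually_abs_sub_lt_pi hf a)
  refine ⟨?_, ?_⟩
  · filter_upwards [h2.filter_mono nhdsWithin_le_nhds, self_mem_nhdsWithin] with x hx hxa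
    obtain ⟨c, hc, hcx⟩ := h x
    rw [sign_neg (sub_neg.2 hxa), sign_eq_neg_one_iff, hcx] at hx
    by_contra! hle
    have := mul_nonneg hc.le (Real.sin_nonneg_of_nonneg_of_le_pi (sub_nonneg.2 hle)
      (abs_lt.1 hx.2).2.le)
    linarith [hx.1]
  · filter_upwards [h2.filter_mono nhdsWithin_le_nhds, self_mem_nhdsWithin] with x hx hxa
    obtain ⟨c, hc, hcx⟩ := h x
    rw [sign_pos (sub_pos.2 hxa), sign_eq_one_iff, hcx] at hx
    by_contra! hle
    have := mul_nonpos_of_nonneg_of_nonpos hc.le (Real.sin_nonpos_of_nonpos_of_neg_pi_le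
      (sub_nonpos.2 hle) (abs_lt.1 hx.2).1.le)
    linarith [hx.1]

theorem deriv_nonneg_of_sin {f g : ℝ → ℝ} {a g' : ℝ} (hf : Continuous f)
    (hg : HasDerivAt g g' a) (hga : g a = 0)
    (h : ∀ x, ∃ c > 0, g x = c * Real.sin (f x - f a)) (hlt : ∀ x, a < x → f a < f x) :
    0 ≤ g' := by
  by_contra! hneg
  have h1 := (crossesUpAt_of_sin (f := fun x => -f x) hf.neg hg.neg (neg_pos.2 hneg)
    (by simp [hga]) fun x => ?_).2
  · obtain ⟨x, hx1, hx2⟩ := (h1.and self_mem_nhdsWithin).exists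
    have := hlt x hx2
    linarith
  · obtain ⟨c, hc, hcx⟩ := h x
    exact ⟨c, hc, by rw [neg_sub_neg, ← neg_sub, Real.sin_neg, Pi.neg_apply, hcx]; ring⟩

theorem cos_pi_div_two_add_int_mul_pi (m : ℤ) : Real.cos (Real.pi / 2 + Real.pi * m) = 0 := by
  rw [Real.cos_eq_zero_iff]; exact ⟨m, by ring⟩

/-- If every zero of `cos ∘ f` on the positive half-line is an upward crossing, each level is
attained at most once and only levels between the values at `0` and at infinity occur. -/
theorem card_add_le_of_crossesUpAt {f : ℝ → ℝ} (hf : Continuous f) {p m : ℤ} {α : ℝ}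
    (hlim : Filter.Tendsto f Filter.atTop (𝓝 (Real.pi * p))) (h0 : f 0 = α + Real.pi * m)
    (hα0 : 0 < α) (hα : α < Real.pi / 2)
    (hup : ∀ a, 0 < a → Real.cos (f a) = 0 → CrossesUpAt f a) {S : Finset ℝ}
    (hS : ∀ a ∈ S, 0 < a ∧ Real.cos (f a) = 0) : (S.card : ℤ) + m ≤ p := by
  have hpi := Real.pi_pos
  have hcos0 : Real.cos (f 0) ≠ 0 := by
    rw [h0, mul_comm, Real.cos_add_int_mul_pi]
    exact mul_ne_zero (zpow_ne_zero _ (by norm_num))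
      (Real.cos_pos_of_mem_Ioo ⟨by linarith, hα⟩).ne'
  have hlevel : ∀ a, 0 < a → Real.cos (f a) = 0 →
      ∀ x, 0 ≤ x → f x = f a → CrossesUpAt f x := by
    intro a _ hca x hx hxa
    rcases hx.eq_or_lt with rfl | hx
    · exact absurd (hxa ▸ hca) hcos0
    · exact hup x hx (hxa ▸ hca)
  have habove : ∀ a, 0 < a → Real.cos (f a) = 0 → ∀ x, a < x → f a < f x :=
    fun a ha hca x hx =>
      lt_of_crossesUpAt hf (fun y hy hye => hlevel a ha hca y (ha.le.trans hy) hye) hx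
  have hbelow : ∀ a, 0 < a → Real.cos (f a) = 0 → f 0 < f a :=
    fun a ha hca => lt_of_crossesUpAt' hf ha (hlevel a ha hca)
  -- If `p < m`, then `f` would descend through the level `π/2 + π(m - 1)`, below `f 0`, whereas
  -- levels met on the positive half-line exceed `f 0`. This matters because the cardinality of `Ico
  -- m p` is truncated at zero.
  have hmp : m ≤ p := by
    by_contra! hlt
    have hpm : (p : ℝ) ≤ m - 1 := by exact_mod_cast (by omega : p ≤ m - 1)
    have hpm' := mul_le_mul_of_nonneg_left hpm hpi.le
    obtain ⟨x, hx, hxe⟩ := exists_ge_eq_of_tendsto (f := fun x => -f x) (a := 0)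
      (L := -(Real.pi / 2 + Real.pi * (m - 1 : ℤ))) hf.neg hlim.neg
      (by rw [h0]; push_cast; linarith) (by push_cast; linarith)
    have hxe' : f x = Real.pi / 2 + Real.pi * (m - 1 : ℤ) := neg_injective hxe
    have hx0 : 0 < x := by
      rcases hx.eq_or_lt with rfl | hx
      · rw [h0] at hxe'; push_cast at hxe'; linarith
      · exact hx
    have := hbelow x hx0 (by rw [hxe', cos_pi_div_two_add_int_mul_pi])
    rw [h0, hxe'] at this
    push_cast at this
    linarith
  have hlev : ∀ a, ∃ i : ℤ, a ∈ S → f a = Real.pi / 2 + Real.pi * i := by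
    intro a
    by_cases ha : a ∈ S
    · obtain ⟨i, hi⟩ := Real.cos_eq_zero_iff.1 (hS a ha).2
      exact ⟨i, fun _ => by rw [hi]; ring⟩
    · exact ⟨0, fun h => absurd h ha⟩
  choose i hi using hlev
  have hcard : S.card ≤ (Finset.Ico m p).card := by
    refine Finset.card_le_card_of_injOn i (fun a ha => ?_) (fun a ha b hb hab => ?_)
    · obtain ⟨ha0, hca⟩ := hS a ha
      have h1 := hbelow a ha0 hca
      rw [h0, hi a ha] at h1
      have h2 : f a ≤ Real.pi * p := ge_of_tendsto hlim
        ((Filter.eventually_gt_atTop a).mono fun x hx => (habove a ha0 hca x hx).le)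
      rw [hi a ha] at h2
      rw [Finset.coe_Ico, Set.mem_Ico]
      constructor
      · have h3 : Real.pi * (m : ℝ) < Real.pi * ((i a : ℝ) + 1) := by linarith
        have h4 := lt_of_mul_lt_mul_left h3 hpi.le
        have : m < i a + 1 := by exact_mod_cast h4
        omega
      · have h3 : Real.pi * (i a : ℝ) < Real.pi * p := by linarith
        exact_mod_cast lt_of_mul_lt_mul_left h3 hpi.le
    · have hfab : f a = f b := by rw [hi a ha, hi b hb]; exact congrArg (fun t : ℤ => _ + _ * (t : ℝ)) hab
      rcases lt_trichotomy a b with h | h | h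
      · exact absurd (habove a (hS a ha).1 (hS a ha).2 b h) (by rw [hfab]; exact lt_irrefl _)
      · exact h
      · exact absurd (habove b (hS b hb).1 (hS b hb).2 a h) (by rw [hfab]; exact lt_irrefl _)
  rw [Int.card_Ico] at hcard
  omega

/-! ### From spectral data to configurations -/

theorem eval_prod_X_sub_C (Z : Multiset ℂ) (x : ℂ) :
    ((Z.map fun z => X - C z).prod).eval x = (Z.map fun z => x - z).prod := by
  rw [eval_multiset_prod, Multiset.map_map]
  simp

theorem exists_eval_eq_mul_cos_sin {Z : Multiset ℂ} (hZ : ∀ z ∈ Z, z.im ≠ 0) :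
    ∃ ρ : ℝ → ℝ, (∀ x y, 0 < ρ x * ρ y) ∧ ∀ x : ℝ,
      (((Z.map fun z => X - C z).prod).eval (x : ℂ)).re = ρ x * Real.cos (phase Z x) ∧
      (((Z.map fun z => X - C z).prod).eval (x : ℂ)).im = ρ x * Real.sin (phase Z x) := by
  obtain ⟨ρ, hρ, h⟩ := prod_sub_eq_mul_exp_phase hZ
  refine ⟨ρ, hρ, fun x => ?_⟩
  rw [eval_prod_X_sub_C, h, mul_comm Complex.I, Complex.exp_mul_I, ← Complex.ofReal_cos,
    ← Complex.ofReal_sin]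
  constructor
  · rw [Complex.re_ofReal_mul]; simp [-Complex.ofReal_cos, -Complex.ofReal_sin]
  · rw [Complex.im_ofReal_mul]; simp [-Complex.ofReal_cos, -Complex.ofReal_sin]

theorem eval_re_eq_zero_iff {Z : Multiset ℂ} (hZ : ∀ z ∈ Z, z.im ≠ 0) (x : ℝ) :
    (((Z.map fun z => X - C z).prod).eval (x : ℂ)).re = 0 ↔ Real.cos (phase Z x) = 0 := by
  obtain ⟨ρ, hρ, h⟩ := exists_eval_eq_mul_cos_sin hZ
  rw [(h x).1, mul_eq_zero_iff_left (left_ne_zero_of_mul (hρ x x).ne')]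

/-- As `cos φ(a) = 0`, the subtraction formula leaves `-cos φ(x) sin φ(a)`. The direction of a phase
crossing thus becomes the sign of a polynomial derivative. -/
theorem neg_re_mul_im_eq_sin {Z : Multiset ℂ} (hZ : ∀ z ∈ Z, z.im ≠ 0) {a : ℝ}
    (ha : (((Z.map fun z => X - C z).prod).eval (a : ℂ)).re = 0) (x : ℝ) :
    ∃ c > 0, -(((Z.map fun z => X - C z).prod).eval (x : ℂ)).re *
      (((Z.map fun z => X - C z).prod).eval (a : ℂ)).im =
        c * Real.sin (phase Z x - phase Z a) := by
  have hcos := (eval_re_eq_zero_iff hZ a).1 ha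
  obtain ⟨ρ, hρ, h⟩ := exists_eval_eq_mul_cos_sin hZ
  refine ⟨_, hρ x a, ?_⟩
  rw [(h x).1, (h a).2, Real.sin_sub, hcos]
  ring

theorem exists_eq_add_pi_mul_of_sin_mul_cos_pos {θ : ℝ} (h : 0 < Real.sin θ * Real.cos θ) :
    ∃ (m : ℤ) (α : ℝ), θ = α + Real.pi * m ∧ 0 < α ∧ α < Real.pi / 2 := by
  have hpi := Real.pi_pos
  refine ⟨⌊θ / Real.pi⌋, θ - Real.pi * ⌊θ / Real.pi⌋, by ring, ?_⟩
  set m := ⌊θ / Real.pi⌋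
  set α := θ - Real.pi * m with hα
  have h0 : 0 ≤ α := by
    have := (le_div_iff₀ hpi).1 (Int.floor_le (θ / Real.pi))
    rw [hα]; linarith
  have h1 : α < Real.pi := by
    have := (div_lt_iff₀ hpi).1 (Int.lt_floor_add_one (θ / Real.pi))
    rw [hα]; linarith
  have h2 : 0 < Real.sin (2 * α) := by
    rw [hα, show 2 * (θ - Real.pi * m) = 2 * θ - m * (2 * Real.pi) by ring,
      Real.sin_sub_int_mul_two_pi, Real.sin_two_mul]
    linarith
  constructor
  · rcases h0.eq_or_lt with h3 | h3
    · rw [← h3] at h2; simp at h2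
    · exact h3
  · by_contra! h3
    have h4 := Real.sin_nonneg_of_nonneg_of_le_pi (x := 2 * α - Real.pi) (by linarith)
      (by linarith)
    rw [Real.sin_sub_pi] at h4
    linarith

/-- The factor `λ_j` completes `∏_{i≠j} (-λ_i)` to `-A(0)`, so `F(0) = A(0)(1 + i ∑ r_j)`, even if
some `λ_j` vanishes. -/
theorem residuePoly_eval_zero {n : ℕ} (lam r : Fin n → ℝ) :
    (residuePoly lam fun j => lam j * r j).eval 0 =
      -(∑ j, r j) * (Lagrange.nodal Finset.univ lam).eval 0 := by
  rw [residuePoly, eval_finsetSum, neg_mul, Finset.sum_mul, ← Finset.sum_neg_distrib]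
  refine Finset.sum_congr rfl fun j _ => ?_
  rw [eval_mul, eval_C, Lagrange.nodal_eq_mul_nodal_erase (Finset.mem_univ j), eval_mul]
  simp
  ring

theorem nodal_eval_eq_zero_iff {n : ℕ} {lam : Fin n → ℝ} {x : ℝ} :
    (Lagrange.nodal Finset.univ lam).eval x = 0 ↔ ∃ j, lam j = x := by
  rw [Lagrange.eval_nodal, Finset.prod_eq_zero_iff]
  exact ⟨fun ⟨j, _, h⟩ => ⟨j, (sub_eq_zero.1 h).symm⟩,
    fun ⟨j, h⟩ => ⟨j, Finset.mem_univ j, sub_eq_zero.2 h.symm⟩⟩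

theorem hasDerivAt_eval_neg (p : ℝ[X]) (x : ℝ) :
    HasDerivAt (fun t => p.eval (-t)) (p.derivative.eval (-x) * -1) x :=
  (p.hasDerivAt (-x)).comp x (hasDerivAt_neg x)

/-- If a polynomial with spectral data `lam, r` has zeros `Z`, these form a configuration whose
half-plane counts are given by the signs of `lam`. -/
theorem mem_multConfigurations_of_spectralPoly {n : ℕ} [NeZero n] {lam r : Fin n → ℝ}
    (hinj : Function.Injective lam) (hne : ∀ j, lam j ≠ 0) (hr : ∀ j, 0 < r j) {Z : Multiset ℂ}
    (hF : (Z.map fun z => X - C z).prod = spectralPoly lam r) (hcard : Z.card = n) :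
    Z ∈ multConfigurations n ∧
      Z.countP (fun z => 0 < z.im) = (Finset.univ.filter fun j => 0 < lam j).card ∧
      Z.countP (fun z => z.im < 0) = (Finset.univ.filter fun j => lam j < 0).card := by
  set A := Lagrange.nodal Finset.univ lam with hA
  set B := residuePoly lam fun j => lam j * r j with hB
  have hre : ∀ x : ℝ, (((Z.map fun z => X - C z).prod).eval (x : ℂ)).re = A.eval x := fun x => by
    rw [hF, spectralPoly_eval_re]
  have him : ∀ x : ℝ, (((Z.map fun z => X - C z).prod).eval (x : ℂ)).im = -B.eval x := fun x => by
    rw [hF, spectralPoly_eval_im]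
  have hBnode : ∀ j, B.eval (lam j) = lam j * r j * A.derivative.eval (lam j) := fun j =>
    residuePoly_eval_node _ _ j
  have hA' : ∀ j, A.derivative.eval (lam j) ≠ 0 := derivative_nodal_eval_ne_zero hinj
  have hAnode : ∀ j, A.eval (lam j) = 0 := fun j => nodal_eval_eq_zero_iff.2 ⟨j, rfl⟩
  -- A real zero of `F` is a zero of `A`, hence some `λ_j`, where the imaginary part `-λ_j r_j
  -- A'(λ_j)` is nonzero.
  have hZ : ∀ z ∈ Z, z.im ≠ 0 := by
    intro z hz hz0
    have hzr : ((z.re : ℝ) : ℂ) = z := Complex.ext (by simp) (by simp [hz0])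
    have h0 : ((Z.map fun z => X - C z).prod).eval ((z.re : ℝ) : ℂ) = 0 := by
      rw [eval_prod_X_sub_C, hzr]
      exact Multiset.prod_eq_zero (Multiset.mem_map.2 ⟨z, hz, sub_self z⟩)
    have h1 := hre z.re
    have h2 := him z.re
    rw [h0] at h1 h2
    obtain ⟨j, hj⟩ := nodal_eval_eq_zero_iff.1 h1.symm
    rw [← hj, hBnode] at h2
    have := mul_ne_zero (mul_ne_zero (hne j) (hr j).ne') (hA' j)
    exact this (neg_eq_zero.1 h2.symm)
  have hcos : ∀ x, Real.cos (phase Z x) = 0 ↔ ∃ j, lam j = x := fun x => by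
    rw [← eval_re_eq_zero_iff hZ, hre]; exact nodal_eval_eq_zero_iff
  have hphase0 : 0 < Real.sin (phase Z 0) * Real.cos (phase Z 0) := by
    obtain ⟨ρ, hρ, h⟩ := exists_eval_eq_mul_cos_sin hZ
    have h1 := (h 0).1
    have h2 := (h 0).2
    rw [hre] at h1
    rw [him, residuePoly_eval_zero] at h2
    have hA0 : A.eval 0 ≠ 0 := fun h => by
      obtain ⟨j, hj⟩ := nodal_eval_eq_zero_iff.1 h
      exact hne j hj
    have hsum : 0 < ∑ j, r j := Finset.sum_pos (fun j _ => hr j) Finset.univ_nonempty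
    have h3 : 0 < (∑ j, r j) * A.eval 0 ^ 2 := by positivity
    have h4 : (∑ j, r j) * A.eval 0 ^ 2 =
        (ρ 0 * ρ 0) * (Real.sin (phase Z 0) * Real.cos (phase Z 0)) := by
      have h5 : (∑ j, r j) * A.eval 0 = ρ 0 * Real.sin (phase Z 0) := by
        rw [← h2]; ring
      calc (∑ j, r j) * A.eval 0 ^ 2 = ((∑ j, r j) * A.eval 0) * A.eval 0 := by ring
        _ = _ := by rw [h5, h1]; ring
    rw [h4] at h3
    exact pos_of_mul_pos_right h3 (hρ 0 0).le
  obtain ⟨m, α, hm, hα0, hα⟩ := exists_eq_add_pi_mul_of_sin_mul_cos_pos hphase0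
  have hsin : ∀ j x, ∃ c > 0, A.eval x * B.eval (lam j) =
      c * Real.sin (phase Z x - phase Z (lam j)) := fun j x => by
    obtain ⟨c, hc, h⟩ := neg_re_mul_im_eq_sin hZ ((hre (lam j)).trans (hAnode j)) x
    exact ⟨c, hc, by rw [← h, hre, him]; ring⟩
  have hpos : ((Finset.univ.filter fun j => 0 < lam j).card : ℤ) + m ≤
      (Z.countP fun z => 0 < z.im : ℕ) := by
    rw [← Finset.card_image_of_injective _ hinj]
    refine card_add_le_of_crossesUpAt (continuous_phase Z)
      (by exact_mod_cast tendsto_phase_atTop hZ) hm hα0 hα ?_ ?_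
    · intro a ha hca
      obtain ⟨j, rfl⟩ := (hcos a).1 hca
      refine crossesUpAt_of_sin (continuous_phase Z)
        ((A.hasDerivAt (lam j)).mul_const (B.eval (lam j))) ?_ (by rw [hAnode, zero_mul]) (hsin j)
      rw [hBnode]
      have h1 := hA' j
      have h2 := hr j
      calc 0 < lam j * r j * (A.derivative.eval (lam j)) ^ 2 := by positivity
        _ = _ := by ring
    · intro a ha
      obtain ⟨j, hj, rfl⟩ := Finset.mem_image.1 ha
      exact ⟨(Finset.mem_filter.1 hj).2, (hcos _).2 ⟨j, rfl⟩⟩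
  have hneg : ((Finset.univ.filter fun j => lam j < 0).card : ℤ) + m ≤
      (Z.countP fun z => z.im < 0 : ℕ) := by
    rw [← Finset.card_image_of_injective _ (neg_injective.comp hinj)]
    refine card_add_le_of_crossesUpAt ((continuous_phase Z).comp continuous_neg)
      (by exact_mod_cast tendsto_phase_neg_atTop hZ) (by simpa using hm) hα0 hα ?_ ?_
    · intro a ha hca
      obtain ⟨j, hj⟩ := (hcos (-a)).1 hca
      obtain rfl : a = -lam j := by rw [hj, neg_neg]
      have hd : HasDerivAt (fun x => A.eval (-x) * B.eval (lam j))
          (A.derivative.eval (lam j) * -1 * B.eval (lam j)) (-lam j) := by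
        refine HasDerivAt.mul_const ?_ _
        simpa only [neg_neg] using hasDerivAt_eval_neg A (-lam j)
      refine crossesUpAt_of_sin ((continuous_phase Z).comp continuous_neg) hd ?_
        (by rw [neg_neg, hAnode, zero_mul]) fun x => ?_
      · rw [hBnode]
        have h1 := hA' j
        have h2 := hr j
        calc 0 < -lam j * r j * (A.derivative.eval (lam j)) ^ 2 := by positivity
          _ = _ := by ring
      · simpa using hsin j (-x)
    · intro a ha
      obtain ⟨j, hj, rfl⟩ := Finset.mem_image.1 ha
      refine ⟨neg_pos.2 (Finset.mem_filter.1 hj).2, ?_⟩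
      simp only [Function.comp, neg_neg]
      exact (hcos _).2 ⟨j, rfl⟩
  have htot : (Finset.univ.filter fun j => 0 < lam j).card +
      (Finset.univ.filter fun j => lam j < 0).card = n := by
    have h1 := Finset.card_filter_add_card_filter_not (s := Finset.univ) (fun j => 0 < lam j)
    rw [Finset.card_univ, Fintype.card_fin] at h1
    refine Eq.trans ?_ h1
    congr 2
    refine Finset.filter_congr fun j _ => ?_
    rw [not_lt]
    exact ⟨le_of_lt, fun h => lt_of_le_of_ne h (hne j)⟩
  have htotZ := countP_im_add_countP_im hZ
  have hm0 : 0 ≤ m := by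
    by_contra! hlt
    have h1 : (m : ℝ) ≤ -1 := by exact_mod_cast (by omega : m ≤ -1)
    have h2 := mul_le_mul_of_nonneg_left h1 Real.pi_pos.le
    have h3 := phase_nonneg Z 0
    rw [hm] at h3
    linarith [Real.pi_pos]
  -- Adding the two crossing counts gives `n + 2m ≤ n`; with `m ≥ 0` both counts become equalities.
  have hm1 : m = 0 := by omega
  subst hm1
  refine ⟨⟨hcard, hZ, ?_⟩, by omega, by omega⟩
  rw [sum_argModPi_eq_phase hZ, hm]
  simpa using hα

/-! ### From configurations to spectral data -/

theorem exists_re_im_parts (Z : Multiset ℂ) : ∃ a b : ℝ[X],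
    (Z.map fun z => X - C z).prod = a.map Complex.ofRealHom + C Complex.I * b.map Complex.ofRealHom
      ∧ a.Monic ∧ a.natDegree = Z.card ∧ b.degree < Z.card := by
  induction Z using Multiset.induction_on with
  | empty => exact ⟨1, 0, by simp, monic_one, by simp, by simp⟩
  | cons z Z ih =>
    obtain ⟨a, b, h, ha, had, hb⟩ := ih
    have hdeg : a.degree = Z.card := by rw [degree_eq_natDegree ha.ne_zero, had]
    have hd1 : ((X - C z.re) * a).degree = ((Z.card + 1 : ℕ) : WithBot ℕ) := by
      rw [degree_mul, degree_X_sub_C, hdeg, add_comm]; rfl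
    have hd2 : (C z.im * b).degree < ((Z.card + 1 : ℕ) : WithBot ℕ) :=
      (degree_C_mul_le_degree _ _).trans_lt (hb.trans (Nat.cast_lt.2 (Nat.lt_succ_self _)))
    refine ⟨(X - C z.re) * a + C z.im * b, (X - C z.re) * b - C z.im * a, ?_, ?_, ?_, ?_⟩
    · have hz : (C z : ℂ[X]) = C (z.re : ℂ) + C Complex.I * C (z.im : ℂ) := by
        rw [← C_mul, ← C_add]
        congr 1
        conv_lhs => rw [← Complex.re_add_im z]
        ring
      have hI : (C Complex.I * C Complex.I : ℂ[X]) = -1 := by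
        rw [← C_mul, Complex.I_mul_I, C_neg, C_1]
      rw [Multiset.map_cons, Multiset.prod_cons, h, hz]
      simp only [Polynomial.map_add, Polynomial.map_sub, Polynomial.map_mul, map_X, map_C,
        Complex.ofRealHom_eq_coe]
      linear_combination (-C (z.im : ℂ) * b.map Complex.ofRealHom) * hI
    · exact ((monic_X_sub_C _).mul ha).add_of_left (by rw [hd1]; exact hd2)
    · rw [natDegree_eq_of_degree_eq_some]
      rw [degree_add_eq_left_of_degree_lt (by rw [hd1]; exact hd2), hd1, Multiset.card_cons]
    · rw [Multiset.card_cons]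
      refine (degree_sub_le _ _).trans_lt (max_lt ?_ ?_)
      · rw [degree_mul, degree_X_sub_C]
        rcases eq_or_ne b 0 with rfl | hb0
        · simp
        · rw [degree_eq_natDegree hb0] at hb ⊢
          have : b.natDegree < Z.card := Nat.cast_lt.1 hb
          exact_mod_cast (by omega : 1 + b.natDegree < Z.card + 1)
      · refine (degree_C_mul_le_degree _ _).trans_lt ?_
        rw [hdeg]
        exact Nat.cast_lt.2 (Nat.lt_succ_self _)

/-- Between `f 0 < π/2` and the limit `πp` lie exactly the `p` levels `π/2 + πi`, `i < p`. -/
theorem exists_pos_phase_eq {f : ℝ → ℝ} (hf : Continuous f) {p : ℕ}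
    (hlim : Filter.Tendsto f Filter.atTop (𝓝 (Real.pi * p))) (h0 : f 0 < Real.pi / 2) :
    ∃ x : Fin p → ℝ, ∀ i, 0 < x i ∧ f (x i) = Real.pi / 2 + Real.pi * (i : ℕ) := by
  have h : ∀ i : Fin p, ∃ x, 0 < x ∧ f x = Real.pi / 2 + Real.pi * (i : ℕ) := by
    intro i
    have hpi := Real.pi_pos
    have h1 : (0 : ℝ) ≤ (i : ℕ) := Nat.cast_nonneg _
    have h2 : ((i : ℕ) : ℝ) + 1 ≤ p := by exact_mod_cast i.2
    have h3 := mul_le_mul_of_nonneg_left h2 hpi.le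
    have h4 := mul_nonneg hpi.le h1
    obtain ⟨x, hx, hxe⟩ := exists_ge_eq_of_tendsto hf hlim (a := 0)
      (L := Real.pi / 2 + Real.pi * (i : ℕ)) (by linarith) (by linarith)
    refine ⟨x, lt_of_le_of_ne hx ?_, hxe⟩
    rintro rfl
    linarith
  choose x hx using h
  exact ⟨x, hx⟩

/-- If every level is attained at only one point of the positive half-line, `f` exceeds it
afterwards. -/
theorem lt_of_unique_crossing {f : ℝ → ℝ} (hf : Continuous f) {p : ℕ}
    (hlim : Filter.Tendsto f Filter.atTop (𝓝 (Real.pi * p))) {i : ℕ} (hi : i < p) {a : ℝ}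
    (ha : f a = Real.pi / 2 + Real.pi * i) (huniq : ∀ x, a ≤ x → f x = f a → x = a) {x : ℝ}
    (hx : a < x) : f a < f x := by
  by_contra! hle
  have hpi := Real.pi_pos
  have h2 : (i : ℝ) + 1 ≤ p := by exact_mod_cast hi
  have h3 := mul_le_mul_of_nonneg_left h2 hpi.le
  obtain ⟨y, hy, hye⟩ := exists_ge_eq_of_tendsto hf hlim hle (by rw [ha]; linarith)
  have := huniq y (hx.le.trans hy) hye
  linarith

/-- Every configuration is the zero set of a polynomial with spectral data `lam, r`. -/
theorem exists_spectralPoly_of_mem_multConfigurations {n : ℕ} {Z : Multiset ℂ}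
    (hZn : Z ∈ multConfigurations n) : ∃ lam r : Fin n → ℝ, Function.Injective lam ∧
      (∀ j, lam j ≠ 0) ∧ (∀ j, 0 < r j) ∧
      (Z.map fun z => X - C z).prod = spectralPoly lam r := by
  obtain ⟨hcard, hZ, hsum⟩ := hZn
  rw [sum_argModPi_eq_phase hZ] at hsum
  have hpi := Real.pi_pos
  have hcont := continuous_phase Z
  have hcont' : Continuous fun x => phase Z (-x) := hcont.comp continuous_neg
  have hlim := tendsto_phase_atTop hZ
  have hlim' := tendsto_phase_neg_atTop hZ
  obtain ⟨x, hx⟩ := exists_pos_phase_eq hcont hlim hsum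
  obtain ⟨y, hy⟩ := exists_pos_phase_eq hcont' hlim' (by simpa using hsum)
  have hpq := (countP_im_add_countP_im hZ).trans hcard
  generalize Z.countP (fun z => 0 < z.im) = p at *
  generalize Z.countP (fun z => z.im < 0) = q at *
  have hlevel_inj : ∀ {i j : ℕ}, Real.pi / 2 + Real.pi * i = Real.pi / 2 + Real.pi * j → i = j := by
    intro i j h
    have := mul_left_cancel₀ hpi.ne' (add_left_cancel h)
    exact_mod_cast this
  have hxinj : Function.Injective x := fun i j hij =>
    Fin.ext (hlevel_inj ((hx i).2.symm.trans ((congrArg (phase Z) hij).trans (hx j).2)))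
  have hyinj : Function.Injective y := fun i j hij =>
    Fin.ext (hlevel_inj ((hy i).2.symm.trans ((congrArg (fun t => phase Z (-t)) hij).trans (hy j).2)))
  have e : Fin n ≃ Fin p ⊕ Fin q := Fintype.equivOfCardEq (by simp [hpq])
  set ν : Fin p ⊕ Fin q → ℝ := Sum.elim x fun i => -y i with hν
  have hνinj : Function.Injective ν := by
    refine hxinj.sumElim (neg_injective.comp hyinj) fun i j => ?_
    have h1 := (hx i).1
    have h2 := (hy j).1
    intro h
    have h' : x i = -y j := h
    linarith
  have hνne : ∀ s, ν s ≠ 0 := by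
    rintro (i | i)
    · exact (hx i).1.ne'
    · exact neg_ne_zero.2 (hy i).1.ne'
  have hνcos : ∀ s, Real.cos (phase Z (ν s)) = 0 := by
    have h : ∀ i : ℕ, Real.cos (Real.pi / 2 + Real.pi * i) = 0 := fun i => by
      simpa using cos_pi_div_two_add_int_mul_pi i
    rintro (i | i)
    · simp only [hν, Sum.elim_inl, (hx i).2, h]
    · simp only [hν, Sum.elim_inr, (hy i).2, h]
  set lam : Fin n → ℝ := ν ∘ e with hlam
  have hinj : Function.Injective lam := hνinj.comp e.injective
  obtain ⟨a, b, hF, ham, had, hbd⟩ := exists_re_im_parts Z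
  rw [hcard] at had hbd
  set F := (Z.map fun z => X - C z).prod with hFdef
  have hev : ∀ t : ℝ, F.eval (t : ℂ) = (a.eval t : ℝ) + Complex.I * (b.eval t : ℝ) := fun t => by
    rw [hF, eval_add, eval_mul, eval_C, eval_map_ofRealHom, eval_map_ofRealHom]
  have hre : ∀ t : ℝ, (F.eval (t : ℂ)).re = a.eval t := fun t => by simp [hev]
  have him : ∀ t : ℝ, (F.eval (t : ℂ)).im = b.eval t := fun t => by simp [hev]
  have hanode : ∀ s, a.eval (ν s) = 0 := fun s => by
    rw [← hre]; exact (eval_re_eq_zero_iff hZ _).2 (hνcos s)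
  -- The `p + q = n` crossings found are distinct zeros of the monic degree-`n` polynomial `a`, so
  -- there are no others.
  have hA : a = Lagrange.nodal Finset.univ lam := by
    refine eq_of_degree_sub_lt_of_eval_index_eq Finset.univ hinj.injOn ?_ fun j _ => ?_
    · have h1 : a.degree = (Lagrange.nodal Finset.univ lam).degree := by
        rw [degree_eq_natDegree ham.ne_zero, had, Lagrange.degree_nodal]; simp
      refine (degree_sub_lt_left h1 ham.ne_zero (by rw [ham.leadingCoeff,
        (Lagrange.nodal_monic (s := Finset.univ) (v := lam)).leadingCoeff])).trans_eq ?_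
      rw [h1, Lagrange.degree_nodal]
    · rw [show a.eval (lam j) = 0 from hanode _, Lagrange.eval_nodal_at_node (Finset.mem_univ j)]
  have hcosiff : ∀ t, Real.cos (phase Z t) = 0 → ∃ s, ν s = t := fun t ht => by
    rw [← eval_re_eq_zero_iff hZ, hre, hA, nodal_eval_eq_zero_iff] at ht
    obtain ⟨j, hj⟩ := ht
    exact ⟨e j, hj⟩
  have hbne : ∀ s, b.eval (ν s) ≠ 0 := fun s h => by
    obtain ⟨ρ, hρ, hcs⟩ := exists_eval_eq_mul_cos_sin hZ
    have h1 := (hcs (ν s)).2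
    rw [him, h] at h1
    have h2 := (mul_eq_zero.1 h1.symm).resolve_left (left_ne_zero_of_mul (hρ _ 0).ne')
    have h3 := Real.sin_sq_add_cos_sq (phase Z (ν s))
    rw [h2, hνcos s] at h3
    norm_num at h3
  have ha' : ∀ s, a.derivative.eval (ν s) ≠ 0 := fun s => by
    have := derivative_nodal_eval_ne_zero hinj (e.symm s)
    rw [← hA] at this
    simpa [hlam] using this
  have hsin : ∀ s t, ∃ c > 0, a.eval t * -b.eval (ν s) =
      c * Real.sin (phase Z t - phase Z (ν s)) := fun s t => by
    obtain ⟨c, hc, h⟩ := neg_re_mul_im_eq_sin hZ ((hre (ν s)).trans (hanode s)) t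
    exact ⟨c, hc, by rw [← h, ← hFdef, hre, him]; ring⟩
  -- Each level is met once per half-line, so `φ` lies above it farther from `0`. This fixes the
  -- sign of the derivative, after reflection for negative nodes.
  have hres : ∀ s, 0 < ν s * (a.derivative.eval (ν s) * -b.eval (ν s)) := by
    intro s
    have hne0 : a.derivative.eval (ν s) * -b.eval (ν s) ≠ 0 :=
      mul_ne_zero (ha' s) (neg_ne_zero.2 (hbne s))
    rcases s with i | i
    · refine mul_pos (hx i).1 (lt_of_le_of_ne ?_ hne0.symm)
      refine deriv_nonneg_of_sin hcont
        ((a.hasDerivAt (ν (Sum.inl i))).mul_const (-b.eval (ν (Sum.inl i))))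
        (by rw [hanode, zero_mul]) (hsin _) fun t ht => ?_
      refine lt_of_unique_crossing hcont hlim i.2 (hx i).2 (fun t ht hte => ?_) ht
      obtain ⟨s, rfl⟩ := hcosiff t (by rw [hte]; exact hνcos (Sum.inl i))
      rcases s with j | j
      · have : j = i := Fin.ext (hlevel_inj ((hx j).2.symm.trans (hte.trans (hx i).2)))
        rw [this]; rfl
      · have h1 := (hx i).1
        have h2 := (hy j).1
        simp only [hν, Sum.elim_inr] at ht
        linarith
    · refine mul_pos_of_neg_of_neg (neg_neg_of_pos (hy i).1) (lt_of_le_of_ne ?_ hne0)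
      have hνi : ν (Sum.inr i) = -y i := rfl
      have hd : HasDerivAt (fun t => a.eval (-t) * -b.eval (ν (Sum.inr i)))
          (a.derivative.eval (ν (Sum.inr i)) * -1 * -b.eval (ν (Sum.inr i))) (y i) := by
        rw [hνi]
        exact (hasDerivAt_eval_neg a (y i)).mul_const _
      have h0 := deriv_nonneg_of_sin hcont' hd (by rw [← hνi, hanode, zero_mul])
        (fun t => by simpa only [hνi] using hsin (Sum.inr i) (-t)) fun t ht => ?_
      · linarith
      refine lt_of_unique_crossing hcont' hlim' i.2 (hy i).2 (fun t ht hte => ?_) ht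
      obtain ⟨s, hs⟩ := hcosiff (-t) (by rw [hte]; exact hνcos (Sum.inr i))
      rcases s with j | j
      · have h1 := (hx j).1
        have h2 := (hy i).1
        simp only [hν, Sum.elim_inl] at hs
        linarith
      · obtain rfl : t = y j := neg_injective hs.symm
        have : j = i := Fin.ext (hlevel_inj ((hy j).2.symm.trans (hte.trans (hy i).2)))
        rw [this]
  -- The weights solve `b(λ_j) = -λ_j r_j A'(λ_j)`, the value that the imaginary part of a spectral
  -- polynomial must take at a node.
  refine ⟨lam, fun j => -b.eval (lam j) / (lam j * a.derivative.eval (lam j)), hinj,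
    fun j => hνne _, fun j => ?_, ?_⟩
  · have h1 := hres (e j)
    have h2 : lam j * a.derivative.eval (lam j) ≠ 0 := mul_ne_zero (hνne _) (ha' _)
    have h3 : -b.eval (lam j) / (lam j * a.derivative.eval (lam j)) =
        (lam j * (a.derivative.eval (lam j) * -b.eval (lam j))) /
          (lam j * a.derivative.eval (lam j)) ^ 2 := by
      field_simp
    refine lt_of_lt_of_eq ?_ h3.symm
    exact div_pos h1 (by positivity)
  · set r : Fin n → ℝ := fun j => -b.eval (lam j) / (lam j * a.derivative.eval (lam j)) with hr
    refine eq_of_degree_sub_lt_of_eval_index_eq (v := fun j => (lam j : ℂ)) Finset.univ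
      (Complex.ofReal_injective.comp hinj).injOn ?_ fun j _ => ?_
    · have h1 := spectralPoly_degree_sub_lt lam r
      have h2 : (F - a.map Complex.ofRealHom).degree < n := by
        rw [hF, add_sub_cancel_left]
        exact (degree_C_mul_le_degree _ _).trans_lt (degree_map_le.trans_lt hbd)
      rw [← hA] at h1
      rw [Finset.card_univ, Fintype.card_fin, ← sub_sub_sub_cancel_right _ _ (a.map Complex.ofRealHom)]
      exact (degree_sub_le _ _).trans_lt (max_lt h2 h1)
    · apply Complex.ext
      · rw [hre, spectralPoly_eval_re, hA]
      · rw [him, spectralPoly_eval_im, residuePoly_eval_node, ← hA]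
        have h2 : a.derivative.eval (lam j) ≠ 0 := ha' _
        have h3 : lam j ≠ 0 := hνne _
        simp only [hr]
        field_simp

/-! ### Moments and the main theorem -/

theorem nodal_roots {n : ℕ} (lam : Fin n → ℝ) :
    (Lagrange.nodal Finset.univ lam).roots = Finset.univ.val.map lam := by
  have h := roots_multiset_prod_X_sub_C (Finset.univ.val.map lam)
  rw [Multiset.map_map] at h
  exact h

/-- Writes the moments through `A` and `F` alone, free of the labelling of the nodes, so that equal
polynomials have equal moments. -/
theorem sum_mul_pow_eq {n : ℕ} {lam : Fin n → ℝ} (r : Fin n → ℝ) (hinj : Function.Injective lam)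
    (hne : ∀ j, lam j ≠ 0) (m : ℕ) :
    ∑ j, r j * lam j ^ m = ((Lagrange.nodal Finset.univ lam).roots.map fun x : ℝ =>
      -((spectralPoly lam r).eval (x : ℂ)).im /
        (x * (Lagrange.nodal Finset.univ lam).derivative.eval x) * x ^ m).sum := by
  rw [nodal_roots, Multiset.map_map]
  refine Finset.sum_congr rfl fun j _ => ?_
  simp only [Function.comp, spectralPoly_eval_im, residuePoly_eval_node]
  have h1 := hne j
  have h2 := derivative_nodal_eval_ne_zero hinj j
  field_simp

theorem moments_eq_of_spectralPoly_eq {n : ℕ} {lam r lam' r' : Fin n → ℝ}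
    (hinj : Function.Injective lam) (hne : ∀ j, lam j ≠ 0) (hinj' : Function.Injective lam')
    (hne' : ∀ j, lam' j ≠ 0) (h : spectralPoly lam r = spectralPoly lam' r') (m : ℕ) :
    ∑ j, r j * lam j ^ m = ∑ j, r' j * lam' j ^ m := by
  have hA : Lagrange.nodal Finset.univ lam = Lagrange.nodal Finset.univ lam' :=
    Polynomial.funext fun x => by rw [← spectralPoly_eval_re lam r, h, spectralPoly_eval_re]
  rw [sum_mul_pow_eq r hinj hne, sum_mul_pow_eq r' hinj' hne', h, hA]

theorem det_conj_diagonal {n : ℕ} {U : Matrix (Fin n) (Fin n) ℝ} (hU : U * Uᵀ = 1)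
    (lam : Fin n → ℝ) : (U * diagonal lam * Uᵀ).det = ∏ j, lam j := by
  rw [det_mul, det_mul, mul_right_comm, ← det_mul, hU, det_one, one_mul, det_diagonal]

theorem prod_X_sub_C_eigenvalueMultiset {n : ℕ} (A : Matrix (Fin n) (Fin n) ℂ) :
    ((eigenvalueMultiset A).map fun z => X - C z).prod = A.charpoly :=
  ((IsAlgClosed.splits A.charpoly).eq_prod_roots_of_monic (charpoly_monic A)).symm

theorem card_eigenvalueMultiset {n : ℕ} (A : Matrix (Fin n) (Fin n) ℂ) :
    (eigenvalueMultiset A).card = n := by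
  rw [eigenvalueMultiset, ← (IsAlgClosed.splits A.charpoly).natDegree_eq_card_roots,
    charpoly_natDegree_eq_dim, Fintype.card_fin]

theorem IsJacobi.exists_spectralPoly {n : ℕ} [NeZero n] {J : Matrix (Fin n) (Fin n) ℝ}
    (hJ : IsJacobi J) {k : ℝ} (hk : 0 < k) : ∃ lam r : Fin n → ℝ, Function.Injective lam ∧
      (∀ j, 0 < r j) ∧ J.det = ∏ j, lam j ∧ J.charpoly = Lagrange.nodal Finset.univ lam ∧
      (∀ m, k * (J ^ m) 0 0 = ∑ j, r j * lam j ^ m) ∧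
      (multPerturb J k).charpoly = spectralPoly lam r := by
  obtain ⟨U, lam, hU, rfl, hinj, hne⟩ := hJ.exists_spectral_data
  refine ⟨lam, fun j => k * U 0 j ^ 2, hinj, fun j => mul_pos hk (by have := hne j; positivity),
    det_conj_diagonal hU lam, charpoly_conj_diagonal hU lam, fun m => ?_,
    charpoly_multPerturb hU lam k⟩
  rw [conj_diagonal_pow hU, conj_diagonal_apply, Finset.mul_sum]
  exact Finset.sum_congr rfl fun j _ => by ring

/-- If `λ_j = 0`, then `A` and the residue numerator both vanish at `0`, making `0` a real point of
`Z`. Uniqueness needs this since the competing matrix is not assumed invertible. -/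
theorem ne_zero_of_mem_multConfigurations {n : ℕ} {lam r : Fin n → ℝ} {Z : Multiset ℂ}
    (hZ : Z ∈ multConfigurations n)
    (h : (Z.map fun z => X - C z).prod = spectralPoly lam r) (j : Fin n) : lam j ≠ 0 := by
  intro hj
  have hA : (Lagrange.nodal Finset.univ lam).eval 0 = 0 := nodal_eval_eq_zero_iff.2 ⟨j, hj⟩
  have h0 : (spectralPoly lam r).eval ((0 : ℝ) : ℂ) = 0 := by
    rw [spectralPoly_eval, residuePoly_eval_zero, hA]
    simp
  rw [← h, eval_prod_X_sub_C, Multiset.prod_eq_zero_iff, Multiset.mem_map] at h0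
  obtain ⟨z, hz, hz0⟩ := h0
  apply hZ.2.1 z hz
  rw [← sub_eq_zero.1 hz0, Complex.ofReal_im]

theorem corollary5p1 (n : ℕ) [NeZero n] :
    (∀ (J : Matrix (Fin n) (Fin n) ℝ) (k : ℝ), IsJacobi J → J.det ≠ 0 → 0 < k →
      eigenvalueMultiset (multPerturb J k) ∈ multConfigurations n ∧
      (eigenvalueMultiset (multPerturb J k)).countP (fun z => 0 < z.im) =
        (eigenvalueMultiset J).countP (fun x => 0 < x) ∧
      (eigenvalueMultiset (multPerturb J k)).countP (fun z => z.im < 0) =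
        (eigenvalueMultiset J).countP (fun x => x < 0)) ∧
    (∀ Z ∈ multConfigurations n,
      ∃ (J : Matrix (Fin n) (Fin n) ℝ) (k : ℝ),
        (IsJacobi J ∧ J.det ≠ 0 ∧ 0 < k ∧ eigenvalueMultiset (multPerturb J k) = Z) ∧
        ∀ (J' : Matrix (Fin n) (Fin n) ℝ) (k' : ℝ), IsJacobi J' → 0 < k' →
          eigenvalueMultiset (multPerturb J' k') = Z → J' = J ∧ k' = k) := by
  refine ⟨fun J k hJ hdet hk => ?_, fun Z hZ => ?_⟩
  · obtain ⟨lam, r, hinj, hr, hd, hch, -, hF⟩ := hJ.exists_spectralPoly hk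
    rw [hd] at hdet
    have hne : ∀ j, lam j ≠ 0 := fun j => Finset.prod_ne_zero_iff.1 hdet j (Finset.mem_univ j)
    have hroots : eigenvalueMultiset J = Finset.univ.val.map lam := by
      rw [eigenvalueMultiset, hch, nodal_roots]
    obtain ⟨h1, h2, h3⟩ := mem_multConfigurations_of_spectralPoly hinj hne hr
      ((prod_X_sub_C_eigenvalueMultiset _).trans hF) (card_eigenvalueMultiset _)
    refine ⟨h1, ?_, ?_⟩
    · rw [h2, hroots, Multiset.countP_map]; rfl
    · rw [h3, hroots, Multiset.countP_map]; rfl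
  · obtain ⟨lam, r, hinj, hne, hr, hF⟩ := exists_spectralPoly_of_mem_multConfigurations hZ
    have hk : 0 < ∑ j, r j := Finset.sum_pos (fun j _ => hr j) Finset.univ_nonempty
    set k := ∑ j, r j with hkdef
    have hq : ∀ j, 0 < r j / k := fun j => div_pos (hr j) hk
    obtain ⟨U, hU, hU0, hJ⟩ := exists_isJacobi_of_spectral_data (v := fun j => √(r j / k)) hinj
      (fun j => (Real.sqrt_pos.2 (hq j)).ne') (by
        simp only [Real.sq_sqrt (hq _).le]
        rw [← Finset.sum_div, ← hkdef, div_self hk.ne'])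
    have hU0' : (fun j => k * U 0 j ^ 2) = r := funext fun j => by
      rw [hU0, Real.sq_sqrt (hq j).le, mul_div_cancel₀ _ hk.ne']
    have hch := charpoly_multPerturb hU lam k
    rw [hU0', ← hF] at hch
    refine ⟨U * diagonal lam * Uᵀ, k, ⟨hJ, ?_, hk, ?_⟩, fun J' k' hJ' hk' hZ' => ?_⟩
    · rw [det_conj_diagonal hU]
      exact Finset.prod_ne_zero_iff.2 fun j _ => hne j
    · rw [eigenvalueMultiset, hch, roots_multiset_prod_X_sub_C]
    · obtain ⟨lam', r', hinj', -, -, -, hmom', hF'⟩ := hJ'.exists_spectralPoly hk'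
      rw [← prod_X_sub_C_eigenvalueMultiset, hZ'] at hF'
      have hne' := ne_zero_of_mem_multConfigurations hZ hF'
      have hmom : ∀ m, k * ((U * diagonal lam * Uᵀ) ^ m) 0 0 = ∑ j, r j * lam j ^ m := by
        intro m
        rw [conj_diagonal_pow hU, conj_diagonal_apply, Finset.mul_sum, ← hU0']
        exact Finset.sum_congr rfl fun j _ => by ring
      have heq : ∀ m, k' * (J' ^ m) 0 0 = k * ((U * diagonal lam * Uᵀ) ^ m) 0 0 := fun m => by
        rw [hmom, hmom']
        exact moments_eq_of_spectralPoly_eq hinj' hne' hinj hne (hF'.symm.trans hF) m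
      -- The zeroth moment of a Jacobi matrix at `e₁` is `1`, so the scaled one is `k`.
      have hkk : k' = k := by simpa using heq 0
      refine ⟨hJ'.eq_of_moments_eq hJ fun m => ?_, hkk⟩
      have := heq m
      rw [hkk] at this
      exact mul_left_cancel₀ hk.ne' this
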